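/- Let $K$ be a field of characteristic $p>0$ and let $\delta$ be a derivation of $K$ with field of constants $F=\{a\in K : \delta(a)=0\}$. Suppose that $\delta$ is algebraic over $F$ as an $F$-linear map $K\to K$, with minimum polynomial $g\in F[t]$. Let $R=K[t;\delta]$ be the differential polynomial ring, whose elements are the polynomials $a_0+a_1t+\dots+a_mt^m$ with $a_i\in K$, added termwise and multiplied by the rule $ta=at+\delta(a)$ for $a\in K$. Put $x=g(t)$; then the centre of $R$ is the polynomial ring $F[x]$. Let $K(t;\delta)=\{f/c : f\in R,\ 0\neq c\in F[x]\}$ be the ring of central quotients of $R$, which is a central simple algebra over the field $F(x)$, and let $N: K(t;\delta)\to F(x)$ be its reduced norm. For $0\neq f\in R$, the minimal central left multiple of $f$ is the polynomial $h$ of minimal degree among the nonzero elements of the centre $F[x]$ of $R$ that lie in $Rf$, normalised so that $h(t)=\hat h(g(t))$ with $\hat h(x)\in F[x]$ monic. Theorem. Let $f\in R$ have degree $m$ in $t$, and suppose that $\hat h$ has degree $m$ as a polynomial in $x$. (i) If $\hat h$ is irreducible in $F[x]$, then $f$ is irreducible in $R$. (ii) If $f$ is irreducible in $R$, then $N(f)$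 lies in $F[x]$ and is irreducible in $F[x]$. -/

import Mathlib

open Polynomial TensorProduct

noncomputable section

namespace DiffPoly

variable {K : Type*} [Field K] (δ : Derivation ℤ K K)

/-- The field of constants `F = Const(δ) = {a ∈ K | δ a = 0}`. -/
def Const : Subfield K where
  carrier := {a | δ a = 0}
  mul_mem' {a b} ha hb := by
    simp only [Set.mem_ofPred_eq] at ha hb ⊢
    simp [ha, hb]
  one_mem' := by simp
  add_mem' {a b} ha hb := by
    simp only [Set.mem_ofPred_eq] at ha hb ⊢
    simp [ha, hb]
  zero_mem' := by simp
  neg_mem' {a} ha := by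
    simp only [Set.mem_ofPred_eq] at ha ⊢
    simp [ha]
  inv_mem' a ha := by
    simp only [Set.mem_ofPred_eq] at ha ⊢
    simp [Derivation.leibniz_inv, ha]

theorem deriv_const (c : Const δ) : δ (c : K) = 0 := c.2

/-- `δ` as an `F`-linear endomorphism of `K`. -/
def derivEnd : Module.End (Const δ) K where
  toFun := δ
  map_add' := map_add δ
  map_smul' c a := by
    simp [Subfield.smul_def, deriv_const]

/-- `δ` applied to every coefficient of a polynomial. -/
def coeffDeriv : K[X] →+ K[X] where
  toFun g := g.sum fun i a => monomial i (δ a)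
  map_zero' := by simp
  map_add' f g := Polynomial.sum_add_index _ _ _ (by simp) (by simp)

/-- Left multiplication by `t` on left polynomials `∑ aᵢ tⁱ`:
`t · ∑ aᵢ tⁱ = ∑ aᵢ tⁱ⁺¹ + ∑ δ(aᵢ) tⁱ`. -/
def tMul : AddMonoid.End K[X] := AddMonoidHom.mulLeft X + coeffDeriv δ

/-- Left multiplication by the skew polynomial `f = ∑ aᵢ tⁱ`, that is `g ↦ ∑ aᵢ · tⁱ · g`. -/
def leftMul (f : K[X]) : AddMonoid.End K[X] :=
  f.eval₂ (Module.toAddMonoidEnd K K[X]) (tMul δ)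

/-- The action of `∑ aᵢ tⁱ` on `K` as the differential operator `∑ aᵢ δⁱ`. -/
def diffOp (f : K[X]) : Module.End (Const δ) K :=
  f.eval₂ (Algebra.lmul (Const δ) K : K →+* Module.End (Const δ) K) (derivEnd δ)

theorem coeff_coeffDeriv (g : K[X]) (n : ℕ) : (coeffDeriv δ g).coeff n = δ (g.coeff n) := by
  change (g.sum fun i a => monomial i (δ a)).coeff n = _
  rw [Polynomial.sum_def, finsetSum_coeff]
  simp only [coeff_monomial]
  rw [Finset.sum_ite_eq' g.support n]
  split_ifs with h
  · rfl
  · rw [notMem_support_iff.mp h, map_zero]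

theorem tMul_apply (g : K[X]) : tMul δ g = X * g + coeffDeriv δ g := rfl

theorem tMul_monomial (i : ℕ) (a : K) :
    tMul δ (monomial i a) = monomial (i + 1) a + monomial i (δ a) := by
  rw [tMul_apply, X_mul_monomial]
  congr 1
  ext n
  rw [coeff_coeffDeriv, coeff_monomial, coeff_monomial]
  split_ifs <;> simp

theorem tMul_C_mul (a : K) (g : K[X]) :
    tMul δ (C a * g) = C a * tMul δ g + C (δ a) * g := by
  ext n
  cases n <;> simp [tMul_apply, coeff_coeffDeriv] <;> ring

theorem leftMul_add (f g h : K[X]) :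
    leftMul δ (f + g) h = leftMul δ f h + leftMul δ g h :=
  DFunLike.congr_fun (eval₂_add (Module.toAddMonoidEnd K K[X]) (tMul δ)) h

theorem tMul_pow_succ (n : ℕ) (g : K[X]) : (tMul δ ^ (n + 1)) g = tMul δ ((tMul δ ^ n) g) := by
  rw [pow_succ']
  rfl

theorem leftMul_zero : leftMul δ 0 = 0 := eval₂_zero _ _

theorem leftMul_monomial (i : ℕ) (a : K) (g : K[X]) :
    leftMul δ (monomial i a) g = C a * (tMul δ ^ i) g := by
  rw [leftMul, eval₂_monomial, ← smul_eq_C_mul]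
  rfl

theorem leftMul_C (a : K) (g : K[X]) : leftMul δ (C a) g = C a * g := by
  rw [← monomial_zero_left, leftMul_monomial, monomial_zero_left]
  simp

theorem leftMul_C_mul (a : K) (f g : K[X]) :
    leftMul δ (C a * f) g = C a * leftMul δ f g := by
  induction f using Polynomial.induction_on' with
  | add p q hp hq =>
    rw [mul_add, leftMul_add, leftMul_add, hp, hq,
      mul_add]
  | monomial n b =>
    rw [C_mul_monomial, leftMul_monomial, leftMul_monomial, C_mul, mul_assoc]

theorem leftMul_tMul (f g : K[X]) : leftMul δ (tMul δ f) g = tMul δ (leftMul δ f g) := by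
  induction f using Polynomial.induction_on' with
  | add p q hp hq =>
    rw [map_add, leftMul_add, leftMul_add, hp, hq,
      map_add]
  | monomial n b =>
    rw [tMul_monomial, leftMul_add, leftMul_monomial, leftMul_monomial,
      leftMul_monomial, tMul_C_mul, tMul_pow_succ]

theorem leftMul_tMul_pow (n : ℕ) (f g : K[X]) :
    leftMul δ ((tMul δ ^ n) f) g = (tMul δ ^ n) (leftMul δ f g) := by
  induction n with
  | zero => rfl
  | succ n ih =>
    rw [tMul_pow_succ, tMul_pow_succ, leftMul_tMul, ih]

theorem leftMul_leftMul (f g h : K[X]) :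
    leftMul δ (leftMul δ f g) h = leftMul δ f (leftMul δ g h) := by
  induction f using Polynomial.induction_on' with
  | add p q hp hq =>
    rw [leftMul_add, leftMul_add, hp, hq, leftMul_add]
  | monomial n b =>
    rw [leftMul_monomial, leftMul_monomial, leftMul_C_mul, leftMul_tMul_pow]

theorem tMul_pow_one (n : ℕ) : (tMul δ ^ n) (1 : K[X]) = X ^ n := by
  induction n with
  | zero => rfl
  | succ n ih =>
    rw [tMul_pow_succ, ih, X_pow_eq_monomial, tMul_monomial,
      X_pow_eq_monomial]
    simp

theorem leftMul_one (f : K[X]) : leftMul δ f 1 = f := by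
  induction f using Polynomial.induction_on' with
  | add p q hp hq => rw [leftMul_add, hp, hq]
  | monomial n b => rw [leftMul_monomial, tMul_pow_one, C_mul_X_pow_eq_monomial]

theorem one_leftMul (g : K[X]) : leftMul δ 1 g = g := by
  rw [← C_1, leftMul_C, C_1, one_mul]

end DiffPoly

/-- The differential polynomial ring `K[t; δ]`: left polynomials `a₀ + a₁ t + ⋯ + aₘ tᵐ` over `K`
with termwise addition, and multiplication determined by `t a = a t + δ(a)`. -/
def DiffPoly {K : Type*} [Field K] (_δ : Derivation ℤ K K) : Type _ := K[X]

namespace DiffPoly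

variable {K : Type*} [Field K] (δ : Derivation ℤ K K)

instance : AddCommGroup (DiffPoly δ) := inferInstanceAs (AddCommGroup K[X])

instance : Ring (DiffPoly δ) :=
  { (inferInstance : AddCommGroup (DiffPoly δ)) with
    one := (1 : K[X])
    mul := fun f g => leftMul δ f g
    left_distrib := fun f g h => map_add (leftMul δ f) g h
    right_distrib := fun f g h => leftMul_add δ f g h
    zero_mul := fun g => DFunLike.congr_fun (leftMul_zero δ) g
    mul_zero := fun f => map_zero (leftMul δ f)
    mul_assoc := fun f g h => leftMul_leftMul δ f g h
    one_mul := fun g => one_leftMul δ g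
    mul_one := fun f => leftMul_one δ f }

/-- The coefficients `a₀, a₁, …` of `f = ∑ aᵢ tⁱ`, as an ordinary polynomial. -/
def toPoly : DiffPoly δ ≃+ K[X] := AddEquiv.refl _

variable {δ} in
/-- The degree in `t`, with `deg 0 = -∞`. -/
def degree (f : DiffPoly δ) : WithBot ℕ := (toPoly δ f).degree

theorem toPoly_mul (f g : DiffPoly δ) :
    toPoly δ (f * g) = leftMul δ (toPoly δ f) (toPoly δ g) := rfl

/-- The inclusion of `K` as constants of `K[t; δ]`. -/
def const : K →+* DiffPoly δ where
  toFun a := (toPoly δ).symm (C a)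
  map_one' := rfl
  map_zero' := congrArg (toPoly δ).symm C_0
  map_add' a b := congrArg (toPoly δ).symm C_add
  map_mul' a b := by
    apply (toPoly δ).injective
    rw [toPoly_mul]
    simp [leftMul_C]

/-- The variable `t`. -/
def t : DiffPoly δ := (toPoly δ).symm X

theorem toPoly_const_mul (a : K) (f : DiffPoly δ) :
    toPoly δ (const δ a * f) = C a * toPoly δ f := leftMul_C δ a _

theorem toPoly_t_mul (f : DiffPoly δ) : toPoly δ (t δ * f) = tMul δ (toPoly δ f) := by
  have h : ∀ p : K[X], leftMul δ X p = tMul δ p := fun p => by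
    rw [← monomial_one_one_eq_X, leftMul_monomial]
    simp
  exact h _

theorem toPoly_t_pow (n : ℕ) : toPoly δ (t δ ^ n) = X ^ n := by
  induction n with
  | zero => rfl
  | succ n ih =>
    rw [pow_succ', toPoly_t_mul, ih, X_pow_eq_monomial, tMul_monomial, X_pow_eq_monomial]
    simp

/-- The defining relation `t a = a t + δ(a)`. -/
theorem t_mul_const (a : K) : t δ * const δ a = const δ a * t δ + const δ (δ a) := by
  apply (toPoly δ).injective
  rw [map_add, toPoly_t_mul, toPoly_const_mul]
  change tMul δ (C a) = C a * X + C (δ a)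
  rw [C_mul_X_eq_monomial, ← monomial_zero_left, tMul_monomial, monomial_zero_left]

theorem eq_sum (f : DiffPoly δ) :
    f = (toPoly δ f).sum fun i a => const δ a * t δ ^ i := by
  apply (toPoly δ).injective
  rw [Polynomial.sum_def, map_sum]
  conv_lhs => rw [(toPoly δ f).as_sum_support_C_mul_X_pow]
  refine Finset.sum_congr rfl fun i _ => ?_
  rw [toPoly_const_mul, toPoly_t_pow]

instance : Algebra (Const δ) (DiffPoly δ) :=
  ((const δ).comp (Const δ).subtype).toAlgebra' fun c f => by
    apply (toPoly δ).injective
    change toPoly δ (const δ (c : K) * f) = leftMul δ (toPoly δ f) (C (c : K))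
    rw [toPoly_const_mul]
    have h : ∀ n : ℕ, (tMul δ ^ n) (C (c : K)) = monomial n (c : K) := by
      intro n
      induction n with
      | zero => rfl
      | succ n ih =>
        rw [tMul_pow_succ, ih, tMul_monomial, deriv_const]
        simp
    generalize toPoly δ f = p
    induction p using Polynomial.induction_on' with
    | add p q hp hq => rw [mul_add, leftMul_add, hp, hq]
    | monomial n b =>
      rw [leftMul_monomial, h, C_mul_monomial, C_mul_monomial, mul_comm]

theorem algebraMap_const (c : Const δ) :
    algebraMap (Const δ) (DiffPoly δ) c = const δ (c : K) := rfl

theorem diffOp_add (f g : K[X]) (y : K) : diffOp δ (f + g) y = diffOp δ f y + diffOp δ g y :=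
  DFunLike.congr_fun (eval₂_add (Algebra.lmul (Const δ) K : K →+* Module.End (Const δ) K)
    (derivEnd δ)) y

theorem diffOp_monomial (i : ℕ) (a y : K) :
    diffOp δ (monomial i a) y = a * (derivEnd δ ^ i) y := by
  rw [diffOp, eval₂_monomial]
  rfl

theorem diffOp_C_mul (a : K) (f : K[X]) (y : K) : diffOp δ (C a * f) y = a * diffOp δ f y := by
  induction f using Polynomial.induction_on' with
  | add p q hp hq => rw [mul_add, diffOp_add, diffOp_add, hp, hq, mul_add]
  | monomial n b => rw [C_mul_monomial, diffOp_monomial, diffOp_monomial, mul_assoc]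

theorem diffOp_tMul (f : K[X]) (y : K) : diffOp δ (tMul δ f) y = δ (diffOp δ f y) := by
  induction f using Polynomial.induction_on' with
  | add p q hp hq => rw [map_add, diffOp_add, diffOp_add, hp, hq, map_add]
  | monomial n b =>
    rw [tMul_monomial, diffOp_add, diffOp_monomial, diffOp_monomial, diffOp_monomial, pow_succ',
      Derivation.leibniz, smul_eq_mul, smul_eq_mul, mul_comm (δ b)]
    rfl

theorem diffOp_tMul_pow (n : ℕ) (f : K[X]) (y : K) :
    diffOp δ ((tMul δ ^ n) f) y = (derivEnd δ ^ n) (diffOp δ f y) := by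
  induction n with
  | zero => rfl
  | succ n ih =>
    rw [tMul_pow_succ, diffOp_tMul, ih, pow_succ']
    rfl

theorem diffOp_leftMul (f g : K[X]) (y : K) :
    diffOp δ (leftMul δ f g) y = diffOp δ f (diffOp δ g y) := by
  induction f using Polynomial.induction_on' with
  | add p q hp hq => rw [leftMul_add, diffOp_add, diffOp_add, hp, hq]
  | monomial n b => rw [leftMul_monomial, diffOp_C_mul, diffOp_tMul_pow, diffOp_monomial]

theorem diffOp_sub (f g : K[X]) (y : K) : diffOp δ (f - g) y = diffOp δ f y - diffOp δ g y := by
  rw [eq_sub_iff_add_eq, ← diffOp_add, sub_add_cancel]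

theorem diffOp_map (p : (Const δ)[X]) :
    diffOp δ (p.map (Const δ).subtype) = aeval (derivEnd δ) p := by
  rw [diffOp, eval₂_map, aeval_def]
  rfl

theorem tMul_mem_degreeLT (n : ℕ) (g : K[X]) (hg : g ∈ degreeLT K n) :
    tMul δ g ∈ degreeLT K (n + 1) := by
  rw [mem_degreeLT, degree_lt_iff_coeff_zero] at hg ⊢
  intro m hm
  obtain ⟨m, rfl⟩ : ∃ k, m = k + 1 := ⟨m - 1, by omega⟩
  rw [tMul_apply, coeff_add, coeff_X_mul, coeff_coeffDeriv, hg m (by omega), hg _ (by omega)]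
  simp

theorem tMul_pow_C_sub_mem (n : ℕ) (a : K) :
    (tMul δ ^ n) (C a) - monomial n a ∈ degreeLT K n := by
  induction n with
  | zero => simp
  | succ n ih =>
    have h : (tMul δ ^ (n + 1)) (C a) - monomial (n + 1) a
        = tMul δ ((tMul δ ^ n) (C a) - monomial n a) + monomial n (δ a) := by
      rw [map_sub, tMul_monomial, tMul_pow_succ]
      abel
    rw [h]
    refine Submodule.add_mem _ (tMul_mem_degreeLT δ n _ ih) ?_
    rw [mem_degreeLT]
    exact (degree_monomial_le _ _).trans_lt (by exact_mod_cast n.lt_succ_self)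

theorem leftMul_C_sub_mem (f : K[X]) (a : K) :
    leftMul δ f (C a) - C a * f ∈ degreeLT K f.natDegree := by
  have h : ∀ p : K[X], leftMul δ p (C a) - C a * p
      = p.sum fun i b => C b * ((tMul δ ^ i) (C a) - monomial i a) := by
    intro p
    induction p using Polynomial.induction_on' with
    | add p q hp hq =>
      rw [Polynomial.sum_add_index p q _ (by simp) (by intros; simp [add_mul]), ← hp, ← hq,
        leftMul_add]
      ring
    | monomial n b =>
      rw [Polynomial.sum_monomial_index _ _ (by simp), leftMul_monomial, mul_sub, C_mul_monomial,
        C_mul_monomial, mul_comm a b]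
  rw [h, Polynomial.sum_def]
  refine Submodule.sum_mem _ fun i hi => ?_
  rw [← smul_eq_C_mul]
  refine Submodule.smul_mem _ _ (degreeLT_mono ?_ (tMul_pow_C_sub_mem δ i a))
  exact le_natDegree_of_mem_supp i hi

/-- No nonzero differential operator `∑ aᵢ δⁱ` of order less than the degree of the minimum
polynomial of `δ` vanishes on `K`. -/
theorem eq_zero_of_diffOp_eq_zero (f : K[X]) (hf : ∀ y, diffOp δ f y = 0)
    (hdeg : f.degree < (minpoly (Const δ) (derivEnd δ)).degree) : f = 0 := by
  classical
  by_contra hf0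
  have hex : ∃ n, ∃ q : K[X], q ≠ 0 ∧ (∀ y, diffOp δ q y = 0) ∧ q.natDegree = n :=
    ⟨_, f, hf0, hf, rfl⟩
  obtain ⟨q, hq0, hq, hqn⟩ := Nat.find_spec hex
  have hmin : ∀ r : K[X], (∀ y, diffOp δ r y = 0) → r.degree < q.degree → r = 0 := by
    intro r hr hrd
    by_contra hr0
    have := Nat.find_min' hex ⟨r, hr0, hr, rfl⟩
    rw [← hqn] at this
    exact absurd (natDegree_lt_natDegree hr0 hrd) (by omega)
  set u : K[X] := C q.leadingCoeff⁻¹ * q with hu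
  have hum : u.Monic := by
    rw [hu, mul_comm]
    exact monic_mul_leadingCoeff_inv hq0
  have hud : u.degree = q.degree := by
    rw [hu, mul_comm]
    exact degree_mul_leadingCoeff_inv q hq0
  have huk : ∀ y, diffOp δ u y = 0 := fun y => by rw [hu, diffOp_C_mul, hq, mul_zero]
  have hd : coeffDeriv δ u = 0 := by
    refine hmin _ (fun y => ?_) ?_
    · have : coeffDeriv δ u = tMul δ u - leftMul δ u X := by
        have h : ∀ p : K[X], leftMul δ p X = X * p := by
          intro p
          have := leftMul_leftMul δ p X 1
          induction p using Polynomial.induction_on' with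
          | add p q hp hq =>
            rw [leftMul_add, mul_add, hp (leftMul_leftMul δ p X 1),
              hq (leftMul_leftMul δ q X 1)]
          | monomial n b =>
            have hX : (X : K[X]) = (tMul δ ^ 1) 1 := by rw [tMul_pow_one, pow_one]
            have hXn : (tMul δ ^ n) (X : K[X]) = X ^ (n + 1) := by
              rw [← tMul_pow_one δ (n + 1), pow_succ, hX, pow_one]
              rfl
            rw [leftMul_monomial, hXn, X_mul_monomial, C_mul_X_pow_eq_monomial]
        rw [tMul_apply, h]
        abel
      rw [this, diffOp_sub, diffOp_tMul, diffOp_leftMul, huk, huk, map_zero, sub_zero]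
    · rw [← hud, degree_eq_natDegree hum.ne_zero, degree_lt_iff_coeff_zero]
      intro m hm
      rw [coeff_coeffDeriv]
      rcases hm.eq_or_lt with rfl | hm
      · rw [hum.coeff_natDegree, Derivation.map_one_eq_zero]
      · rw [coeff_eq_zero_of_natDegree_lt hm, map_zero]
  have hl : u ∈ Polynomial.lifts (Const δ).subtype := by
    rw [Polynomial.lifts_iff_coeff_lifts]
    intro n
    refine ⟨⟨u.coeff n, ?_⟩, rfl⟩
    change δ _ = 0
    rw [← coeff_coeffDeriv, hd, coeff_zero]
  obtain ⟨v, hv, hvd, hvm⟩ := lifts_and_degree_eq_and_monic hl hum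
  have hv0 : aeval (derivEnd δ) v = 0 := by
    rw [← diffOp_map, hv]
    exact LinearMap.ext huk
  have h1 := minpoly.min (Const δ) (derivEnd δ) hvm hv0
  rw [hvd, hud] at h1
  exact hf0 (hmin f hf (hdeg.trans_le h1))

/-- The element `x = g(t)` of `K[t; δ]`, where `g ∈ F[t]` is the minimum polynomial of the
`F`-linear map `δ`. -/
def x : DiffPoly δ := aeval (t δ) (minpoly (Const δ) (derivEnd δ))

theorem toPoly_aeval_t (p : (Const δ)[X]) :
    toPoly δ (aeval (t δ) p) = p.map (Const δ).subtype := by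
  rw [aeval_eq_sum_range, map_sum]
  conv_rhs => rw [p.as_sum_range_C_mul_X_pow, Polynomial.map_sum]
  refine Finset.sum_congr rfl fun i _ => ?_
  rw [Algebra.smul_def, algebraMap_const, toPoly_const_mul, toPoly_t_pow]
  simp

theorem x_commute_const (a : K) : Commute (x δ) (const δ a) := by
  apply (toPoly δ).injective
  rw [toPoly_const_mul, toPoly_mul, x, toPoly_aeval_t]
  change leftMul δ _ (C a) = _
  set g := minpoly (Const δ) (derivEnd δ) with hg
  by_cases h0 : g = 0
  · rw [h0, Polynomial.map_zero, leftMul_zero]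
    simp
  have hk : ∀ y, diffOp δ (g.map (Const δ).subtype) y = 0 := fun y => by
    rw [diffOp_map, hg, minpoly.aeval]
    rfl
  rw [← sub_eq_zero]
  refine eq_zero_of_diffOp_eq_zero δ _ (fun y => ?_) ?_
  · rw [diffOp_sub, diffOp_leftMul, diffOp_C_mul, hk, hk, mul_zero, sub_zero]
  · have := leftMul_C_sub_mem δ (g.map (Const δ).subtype) a
    rw [mem_degreeLT] at this
    rw [← hg, degree_eq_natDegree h0]
    simpa using this

theorem x_commute (f : DiffPoly δ) : Commute (x δ) f := by
  have ht : Commute (x δ) (t δ) := by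
    rw [x]
    nth_rewrite 2 [← aeval_X (R := Const δ) (t δ)]
    exact (Commute.all _ _).map (aeval (t δ))
  rw [eq_sum δ f, Polynomial.sum_def]
  exact Commute.sum_right _ _ _ fun i _ => (x_commute_const δ _).mul_right (ht.pow_right i)

/-- `K[t; δ]` as an algebra over the polynomial ring `F[x]`, with `x` acting as `g(t)`:
`p(x)` is sent to the central element `p(g(t))`. -/
instance : Algebra (Const δ)[X] (DiffPoly δ) :=
  (aeval (x δ) : (Const δ)[X] →ₐ[Const δ] DiffPoly δ).toRingHom.toAlgebra' fun p f => by
    change Commute (aeval (x δ) p) f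
    induction p using Polynomial.induction_on' with
    | add p q hp hq => rw [map_add]; exact hp.add_left hq
    | monomial n b =>
      rw [aeval_monomial]
      have hb : Commute (algebraMap (Const δ) (DiffPoly δ) b) f := Algebra.commutes b f
      exact hb.mul_left ((x_commute δ f).pow_left n)

theorem algebraMap_eq_aeval (p : (Const δ)[X]) :
    algebraMap (Const δ)[X] (DiffPoly δ) p = aeval (x δ) p := rfl

variable {δ} in
/-- `ĥ ∈ F[x]` describes the minimal central left multiple `h(t) = ĥ(g(t))` of `f`: it is monic,
and `h` is a central left multiple of `f` whose degree is minimal among the nonzero ones. -/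
structure IsMinimalCentralLeftMultiple (f : DiffPoly δ) (h : (Const δ)[X]) : Prop where
  monic : h.Monic
  isLeftMultiple : ∃ q : DiffPoly δ, algebraMap (Const δ)[X] (DiffPoly δ) h = q * f
  degree_le : ∀ c ∈ Subring.center (DiffPoly δ), c ≠ 0 → (∃ q : DiffPoly δ, c = q * f) →
    (algebraMap (Const δ)[X] (DiffPoly δ) h).degree ≤ c.degree

/-- The ring of central quotients `K(t; δ) = {f / c | f ∈ K[t; δ], 0 ≠ c ∈ F[x]}`, that is the
localization of the `F[x]`-algebra `K[t; δ]` at `F[x] ∖ {0}`, an algebra over `F(x)`. -/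
abbrev CentralQuot : Type _ := RatFunc (Const δ) ⊗[(Const δ)[X]] DiffPoly δ

end DiffPoly

/-- The reduced norm of a central simple algebra `A` over a field `k`: the element of `k` that
equals `det (φ (1 ⊗ a))` for any isomorphism `φ` of `Ω ⊗ A` with a matrix algebra over `Ω`, the
algebraic closure of `k`. (Its value is `0` if there is no such element.) -/
def reducedNorm (k : Type*) [Field k] {A : Type*} [Ring A] [Algebra k A] (a : A) : k :=
  open scoped Classical in
  if h : ∃ c : k, ∃ (n : ℕ) (φ : AlgebraicClosure k ⊗[k] A ≃ₐ[AlgebraicClosure k]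
      Matrix (Fin n) (Fin n) (AlgebraicClosure k)),
      (φ (1 ⊗ₜ a)).det = algebraMap k (AlgebraicClosure k) c
  then h.choose else 0

/-- The reduced norm does not depend on the choice of the splitting isomorphism. -/
theorem reducedNorm_eq {k : Type*} [Field k] {A : Type*} [Ring A] [Algebra k A] (a : A) (c : k)
    (n : ℕ) (φ : AlgebraicClosure k ⊗[k] A ≃ₐ[AlgebraicClosure k]
      Matrix (Fin n) (Fin n) (AlgebraicClosure k))
    (h : (φ (1 ⊗ₜ a)).det = algebraMap k (AlgebraicClosure k) c) : reducedNorm k a = c := by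
  have hex : ∃ c : k, ∃ (n : ℕ) (φ : AlgebraicClosure k ⊗[k] A ≃ₐ[AlgebraicClosure k]
      Matrix (Fin n) (Fin n) (AlgebraicClosure k)),
      (φ (1 ⊗ₜ a)).det = algebraMap k (AlgebraicClosure k) c := ⟨c, n, φ, h⟩
  rw [reducedNorm, dif_pos hex]
  obtain ⟨n', φ', h'⟩ := hex.choose_spec
  have e := φ'.symm.trans φ
  have hn : n' * n' = n * n := by
    have := e.toLinearEquiv.finrank_eq
    rw [Module.finrank_matrix, Module.finrank_matrix] at this
    simpa using this
  obtain rfl : n' = n := Nat.mul_self_inj.mp hn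
  apply (algebraMap k (AlgebraicClosure k)).injective
  rw [← h', ← h]
  obtain ⟨T, hT⟩ := AlgEquiv.eq_linearEquivConjAlgEquiv
    ((Matrix.toLinAlgEquiv' (R := AlgebraicClosure k) (n := Fin n')).symm.trans
      ((φ'.symm.trans φ).trans Matrix.toLinAlgEquiv'))
  have key := DFunLike.congr_fun hT (Matrix.toLin' (φ' (1 ⊗ₜ a)))
  have h3 : Matrix.toLin' (φ (1 ⊗ₜ a)) = T.conjAlgEquiv (AlgebraicClosure k)
      (Matrix.toLin' (φ' (1 ⊗ₜ a))) := by
    rw [← key]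
    change _ = Matrix.toLin' (φ (φ'.symm (LinearMap.toMatrix' (Matrix.toLin' (φ' (1 ⊗ₜ a))))))
    rw [LinearMap.toMatrix'_toLin', AlgEquiv.symm_apply_apply]
  rw [← LinearMap.det_toLin', ← LinearMap.det_toLin' (φ (1 ⊗ₜ a)), h3]
  exact (LinearMap.det_conj _ T).symm

namespace DiffPoly

variable {K : Type*} [Field K] {δ : Derivation ℤ K K}

/-- `N(f) ∈ F(x)`: the reduced norm over `F(x)` of `f ∈ K[t; δ] ⊆ K(t; δ)`. -/
def norm (f : DiffPoly δ) : RatFunc (Const δ) :=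
  reducedNorm (RatFunc (Const δ)) (A := CentralQuot δ) (1 ⊗ₜ f)

end DiffPoly

end

/-! ### Degree, division and left ideals in `K[t; δ]`. -/

noncomputable section

namespace DiffPoly

variable {K : Type*} [Field K] (δ : Derivation ℤ K K)

/-! Let `n` be the degree of the minimum polynomial `g`. Since `x = g(t)` is central of degree `n`,
the ring `R = K[t; δ]` is a free left `K[x]`-module on `1, t, …, tⁿ⁻¹`, and right multiplication by
`f` becomes an `n × n` matrix over `K[x]`. Its determinant, `polyNorm`, is multiplicative and sends
`p ∈ F[x]` to `pⁿ`. It has coefficients in `F`, because differentiating the matrix of `f` amounts to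
taking its commutator with the matrix of `t`. Its degree in `x` is at most `m = deg f`
(`natDegree_polyNorm_le`), and `f` is a unit when it is one.

Now `ĥ = q f` gives `N(f) ∣ ĥⁿ`. If `ĥ` is irreducible, every nonunit factor of `f` has norm
divisible by `ĥ`. A proper factorisation of `f` would thus give `ĥ² ∣ N(f)`, against `deg N(f) ≤ m =
deg ĥ` and `m > 0`. Conversely, if `f` is irreducible then `Rf` is a maximal left ideal and
minimality of `ĥ` makes `ĥ` irreducible; so `ĥ ∣ N(f)`, and comparing degrees makes the two
associated.

It remains to identify `polyNorm` with the reduced norm (`norm_eq`). Over the algebraic closure `Ω`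
of `F(x)`, the matrices define an algebra map from the extension of `K(t; δ)` to `Mₙ(Ω)`. It is onto
(`subalgebra_eq_top`), and the source has dimension at most `n²` because `[K : F] ≤ n`
(`exists_span_const_eq_top`); so it is an isomorphism. -/

theorem degree_coeffDeriv_le (g : K[X]) : (coeffDeriv δ g).degree ≤ g.degree := by
  rw [degree_le_iff_coeff_zero]
  intro m hm
  rw [coeff_coeffDeriv, coeff_eq_zero_of_degree_lt hm, map_zero]

theorem degree_tMul (g : K[X]) : (tMul δ g).degree = g.degree + 1 := by
  rcases eq_or_ne g 0 with rfl | hg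
  · simp
  have hX : (X * g).degree = g.degree + 1 := by rw [degree_mul, degree_X, add_comm]
  rw [tMul_apply, degree_add_eq_left_of_degree_lt, hX]
  rw [hX]
  refine (degree_coeffDeriv_le δ g).trans_lt ?_
  rw [degree_eq_natDegree hg]
  exact_mod_cast Nat.lt_succ_self _

theorem degree_tMul_pow (n : ℕ) (g : K[X]) : ((tMul δ ^ n) g).degree = g.degree + n := by
  induction n with
  | zero => simp
  | succ n ih => rw [tMul_pow_succ, degree_tMul, ih, add_assoc, Nat.cast_succ]

theorem leftMul_eq_sum (f g : K[X]) :
    leftMul δ f g = ∑ i ∈ f.support, C (f.coeff i) * (tMul δ ^ i) g := by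
  conv_lhs => rw [f.as_sum_support]
  induction f.support using Finset.induction_on with
  | empty => simp [leftMul_zero]
  | insert i s hi ih =>
    rw [Finset.sum_insert hi, Finset.sum_insert hi, leftMul_add, leftMul_monomial, ih]

/-- The terms `aᵢ tⁱ g` with `aᵢ ≠ 0` have pairwise distinct degrees `i + deg g`, so nothing
cancels. -/
theorem degree_leftMul (f g : K[X]) : (leftMul δ f g).degree = f.degree + g.degree := by
  rcases eq_or_ne g 0 with rfl | hg
  · simp
  have hdeg : ∀ i ∈ f.support,
      (C (f.coeff i) * (tMul δ ^ i) g).degree = ((i + g.natDegree : ℕ) : WithBot ℕ) := by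
    intro i hi
    rw [degree_C_mul (mem_support_iff.mp hi), degree_tMul_pow, degree_eq_natDegree hg, add_comm]
    rfl
  rw [leftMul_eq_sum, degree_sum_eq_of_disjoint]
  · rw [Finset.sup_congr rfl hdeg, degree_eq_natDegree hg]
    rcases eq_or_ne f 0 with rfl | hf
    · simp
    apply le_antisymm
    · refine Finset.sup_le fun i hi => ?_
      rw [degree_eq_natDegree hf]
      exact_mod_cast Nat.add_le_add_right (le_natDegree_of_mem_supp i hi) _
    · rw [degree_eq_natDegree hf]
      exact Finset.le_sup (f := fun i : ℕ => ((i + g.natDegree : ℕ) : WithBot ℕ))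
        (natDegree_mem_support_of_nonzero hf)
  · intro i hi j hj hij h
    simp only [Function.comp] at h
    rw [hdeg i hi.1, hdeg j hj.1] at h
    have : i + g.natDegree = j + g.natDegree := by exact_mod_cast h
    omega

variable {δ}

theorem degree_mul (f g : DiffPoly δ) : (f * g).degree = f.degree + g.degree :=
  degree_leftMul δ _ _

theorem degree_one : (1 : DiffPoly δ).degree = 0 := Polynomial.degree_one (R := K)

theorem degree_eq_bot {f : DiffPoly δ} : f.degree = ⊥ ↔ f = 0 := Polynomial.degree_eq_bot (R := K)

theorem degree_zero : (0 : DiffPoly δ).degree = ⊥ := degree_eq_bot.mpr rfl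

theorem degree_const {a : K} (ha : a ≠ 0) : (const δ a).degree = 0 := degree_C (R := K) ha

theorem degree_t_pow (n : ℕ) : (t δ ^ n).degree = n := by
  rw [degree, toPoly_t_pow, degree_X_pow]

theorem degree_pow (f : DiffPoly δ) (n : ℕ) : (f ^ n).degree = n • f.degree := by
  induction n with
  | zero => rw [pow_zero, degree_one, zero_nsmul]
  | succ n ih => rw [pow_succ, degree_mul, ih, succ_nsmul]

instance : Nontrivial (DiffPoly δ) := inferInstanceAs (Nontrivial K[X])

instance : NoZeroDivisors (DiffPoly δ) where
  eq_zero_or_eq_zero_of_mul_eq_zero {f g} h := by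
    simpa only [← degree_eq_bot, degree_mul, WithBot.add_eq_bot] using h

theorem degree_eq_coe {f : DiffPoly δ} (hf : f ≠ 0) : ∃ n : ℕ, f.degree = n :=
  ⟨_, Polynomial.degree_eq_natDegree (R := K) hf⟩

/-- Right division: the left ideals of `K[t; δ]` admit a division algorithm. -/
theorem exists_degree_sub_mul_lt (d : DiffPoly δ) (hd : d ≠ 0) (f : DiffPoly δ) :
    ∃ q : DiffPoly δ, (f - q * d).degree < d.degree := by
  obtain ⟨k, hk⟩ := degree_eq_coe hd
  -- Induction on a strict bound for the degree also covers `f = 0`, whose degree is `⊥`.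
  suffices H : ∀ N : ℕ, ∀ f : DiffPoly δ, f.degree < N →
      ∃ q : DiffPoly δ, (f - q * d).degree < d.degree by
    rcases eq_or_ne f 0 with rfl | hf
    · exact H 1 0 (by rw [degree_zero]; exact WithBot.bot_lt_coe _)
    · obtain ⟨n, hn⟩ := degree_eq_coe hf
      exact H (n + 1) f (by rw [hn]; exact_mod_cast Nat.lt_succ_self n)
  intro N
  induction N with
  | zero =>
    intro f hf
    refine ⟨0, ?_⟩
    rw [zero_mul, sub_zero, hk]
    exact hf.trans_le (by exact_mod_cast Nat.zero_le k)
  | succ N ih =>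
    intro f hf
    rcases lt_or_ge f.degree d.degree with h | h
    · exact ⟨0, by rwa [zero_mul, sub_zero]⟩
    have hf0 : f ≠ 0 := by
      rintro rfl
      rw [degree_zero, hk] at h
      exact absurd h (WithBot.bot_lt_coe _).not_ge
    obtain ⟨n, hn⟩ := degree_eq_coe hf0
    rw [hn, hk] at h
    have hkn : k ≤ n := by exact_mod_cast h
    have hnN : n < N + 1 := by rw [hn] at hf; exact_mod_cast hf
    set e : DiffPoly δ := t δ ^ (n - k) * d with he
    have hed : e.degree = n := by
      rw [he, degree_mul, degree_t_pow, hk]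
      exact_mod_cast Nat.sub_add_cancel hkn
    have he0 : toPoly δ e ≠ 0 := by
      intro h0
      have : (toPoly δ e).degree = n := hed
      rw [h0] at this
      simp at this
    set c : K := (toPoly δ f).leadingCoeff / (toPoly δ e).leadingCoeff with hc
    have hc0 : c ≠ 0 := div_ne_zero (leadingCoeff_ne_zero.mpr hf0) (leadingCoeff_ne_zero.mpr he0)
    have hlt : (f - const δ c * e).degree < f.degree := by
      have h1 : toPoly δ (f - const δ c * e) = toPoly δ f - C c * toPoly δ e := by
        rw [map_sub, toPoly_const_mul]
      rw [degree, h1]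
      refine degree_sub_lt_left ?_ hf0 ?_
      · rw [degree_C_mul hc0]
        exact hn.trans hed.symm
      · rw [leadingCoeff_mul, leadingCoeff_C, hc, div_mul_cancel₀]
        exact leadingCoeff_ne_zero.mpr he0
    obtain ⟨q, hq⟩ := ih (f - const δ c * e) (by
      rw [hn] at hlt
      exact hlt.trans_le (by exact_mod_cast Nat.lt_succ_iff.mp hnN))
    refine ⟨const δ c * t δ ^ (n - k) + q, ?_⟩
    rw [add_mul, mul_assoc, ← he, ← sub_sub]
    exact hq

/-- Every left ideal of `K[t; δ]` is principal. -/
theorem exists_eq_mul_of_mem (I : Ideal (DiffPoly δ)) :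
    ∃ d ∈ I, ∀ f ∈ I, ∃ q, f = q * d := by
  classical
  by_cases hI : ∃ n : ℕ, ∃ d ∈ I, d.degree = n
  · obtain ⟨d, hd, hdn⟩ := Nat.find_spec hI
    have hd0 : d ≠ 0 := by
      rintro rfl
      rw [degree_zero] at hdn
      exact WithBot.bot_ne_coe hdn
    refine ⟨d, hd, fun f hf => ?_⟩
    obtain ⟨q, hq⟩ := exists_degree_sub_mul_lt d hd0 f
    refine ⟨q, ?_⟩
    by_contra hne
    obtain ⟨k, hk⟩ := degree_eq_coe (sub_ne_zero.mpr hne)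
    have hmem : f - q * d ∈ I := I.sub_mem hf (I.mul_mem_left q hd)
    have := Nat.find_min' hI ⟨_, hmem, hk⟩
    rw [hk, hdn] at hq
    exact absurd (by exact_mod_cast hq) this.not_gt
  · refine ⟨0, I.zero_mem, fun f hf => ⟨0, ?_⟩⟩
    by_contra hne
    rw [mul_zero] at hne
    obtain ⟨k, hk⟩ := degree_eq_coe hne
    exact hI ⟨k, f, hf, hk⟩

/-- In a domain a one-sided inverse is two-sided: `(f v - 1) f = f (v f) - f = 0`. -/
theorem isUnit_of_mul_eq_one_left {f v : DiffPoly δ} (h : v * f = 1) : IsUnit f := by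
  have hf : f ≠ 0 := by
    rintro rfl
    simp at h
  have h2 : f * v = 1 := by
    have : (f * v - 1) * f = 0 := by rw [sub_mul, mul_assoc, h]; simp
    exact sub_eq_zero.mp ((mul_eq_zero.mp this).resolve_right hf)
  exact ⟨⟨f, v, h2, h⟩, rfl⟩

/-- An irreducible `f` generates a maximal left ideal. -/
theorem exists_bezout_of_irreducible {f a : DiffPoly δ} (hf : Irreducible f)
    (ha : ¬ ∃ q, a = q * f) : ∃ u v, u * f + v * a = 1 := by
  obtain ⟨d, hd, hI⟩ := exists_eq_mul_of_mem (Ideal.span {f} ⊔ Ideal.span {a})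
  obtain ⟨u, hu⟩ := hI f (Ideal.mem_sup_left (Ideal.mem_span_singleton_self f))
  obtain ⟨v, hv⟩ := hI a (Ideal.mem_sup_right (Ideal.mem_span_singleton_self a))
  -- With `d` a generator of `Rf + Ra` and `f = u d`: if `u` is a unit, then `a ∈ Rd = Rf`, which is
  -- excluded; if `d` is a unit, the ideal is all of `R`.
  rcases hf.isUnit_or_isUnit hu with ⟨u, rfl⟩ | ⟨d, rfl⟩
  · refine absurd ⟨v * ↑u⁻¹, ?_⟩ ha
    rw [hu, mul_assoc, Units.inv_mul_cancel_left, hv]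
  · have h1 : (1 : DiffPoly δ) ∈ Ideal.span {f} ⊔ Ideal.span {a} := by
      rw [← Units.inv_mul d]
      exact Ideal.mul_mem_left _ _ hd
    obtain ⟨y, hy, z, hz, hyz⟩ := Submodule.mem_sup.mp h1
    obtain ⟨u, rfl⟩ := Ideal.mem_span_singleton'.mp hy
    obtain ⟨v, rfl⟩ := Ideal.mem_span_singleton'.mp hz
    exact ⟨u, v, hyz⟩

end DiffPoly
end

/-! ### `K[t; δ]` as a free module over `K[x]`. -/

noncomputable section

namespace DiffPoly

variable {K : Type*} [Field K] (δ : Derivation ℤ K K)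

/-- The degree of the minimum polynomial of `δ`. -/
def order : ℕ := (minpoly (Const δ) (derivEnd δ)).natDegree

/-- The embedding of the polynomial ring `K[X]` in `K[t; δ]` with `X ↦ x`. -/
def ofPoly : K[X] →+* DiffPoly δ :=
  eval₂RingHom' (const δ) (x δ) fun a => (x_commute_const δ a).symm

theorem ofPoly_eq_sum (p : K[X]) :
    ofPoly δ p = ∑ k ∈ p.support, const δ (p.coeff k) * x δ ^ k := by
  change p.eval₂ (const δ) (x δ) = _
  rw [eval₂_eq_sum, Polynomial.sum_def]

theorem ofPoly_C (a : K) : ofPoly δ (C a) = const δ a := eval₂_C _ _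

theorem ofPoly_X : ofPoly δ X = x δ := eval₂_X _ _

theorem ofPoly_map (p : (Const δ)[X]) :
    ofPoly δ (p.map (Const δ).subtype) = algebraMap (Const δ)[X] (DiffPoly δ) p := by
  change (p.map (Const δ).subtype).eval₂ (const δ) (x δ) = _
  rw [eval₂_map, algebraMap_eq_aeval, aeval_def]
  rfl

/-- `K[t; δ]` as a left module over `K[x]`. -/
instance : Module K[X] (DiffPoly δ) := Module.compHom (DiffPoly δ) (ofPoly δ)

variable {δ}

theorem smul_eq_ofPoly_mul (p : K[X]) (f : DiffPoly δ) : p • f = ofPoly δ p * f := rfl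

theorem C_smul (a : K) (f : DiffPoly δ) : (C a : K[X]) • f = const δ a * f := by
  rw [smul_eq_ofPoly_mul, ofPoly_C]

theorem map_smul_eq (p : (Const δ)[X]) (f : DiffPoly δ) :
    p.map (Const δ).subtype • f = p • f := by
  rw [smul_eq_ofPoly_mul, ofPoly_map, Algebra.smul_def]

variable (hδ : IsIntegral (Const δ) (derivEnd δ))

include hδ

theorem order_pos : 0 < order δ := minpoly.natDegree_pos hδ

theorem degree_x : (x δ).degree = order δ := by
  rw [degree, x, toPoly_aeval_t, degree_map, degree_eq_natDegree (minpoly.ne_zero hδ), order]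

theorem degree_x_pow_mul_t_pow (k i : ℕ) :
    (x δ ^ k * t δ ^ i).degree = ((order δ * k + i : ℕ) : WithBot ℕ) := by
  rw [degree_mul, degree_pow, degree_x hδ, degree_t_pow, ← Nat.cast_smul_eq_nsmul ℕ,
    Nat.cast_id, nsmul_eq_mul, mul_comm]
  norm_cast

theorem degree_ofPoly {p : K[X]} (hp : p ≠ 0) :
    (ofPoly δ p).degree = ((order δ * p.natDegree : ℕ) : WithBot ℕ) := by
  have hdeg : ∀ k ∈ p.support, (toPoly δ (const δ (p.coeff k) * x δ ^ k)).degree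
      = ((order δ * k : ℕ) : WithBot ℕ) := by
    intro k hk
    change (const δ (p.coeff k) * x δ ^ k).degree = _
    rw [degree_mul, degree_const (mem_support_iff.mp hk), zero_add]
    simpa using degree_x_pow_mul_t_pow hδ k 0
  rw [ofPoly_eq_sum, degree, map_sum, degree_sum_eq_of_disjoint, Finset.sup_congr rfl hdeg]
  · apply le_antisymm
    · refine Finset.sup_le fun i hi => ?_
      exact_mod_cast Nat.mul_le_mul_left _ (le_natDegree_of_mem_supp i hi)
    · exact Finset.le_sup (f := fun i : ℕ => ((order δ * i : ℕ) : WithBot ℕ))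
        (natDegree_mem_support_of_nonzero hp)
  · intro i hi j hj hij h
    simp only [Function.comp] at h
    rw [hdeg i hi.1, hdeg j hj.1] at h
    have h' : order δ * i = order δ * j := by exact_mod_cast h
    exact hij (Nat.eq_of_mul_eq_mul_left (order_pos hδ) h')

theorem degree_smul_t_pow {p : K[X]} (hp : p ≠ 0) (i : ℕ) :
    (p • t δ ^ i).degree = ((order δ * p.natDegree + i : ℕ) : WithBot ℕ) := by
  rw [smul_eq_ofPoly_mul, degree_mul, degree_ofPoly hδ hp, degree_t_pow]
  norm_cast

/-- The nonzero terms have degrees `n · deg cᵢ + i`, distinct modulo `n`, so they cannot cancel.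
This yields both the independence of the powers of `t` and the degree bounds on coordinates. -/
theorem degree_sum_smul_t_pow (c : Fin (order δ) → K[X]) :
    (∑ i, c i • t δ ^ (i : ℕ)).degree = Finset.univ.sup fun i => (c i • t δ ^ (i : ℕ)).degree := by
  rw [degree, map_sum, degree_sum_eq_of_disjoint]
  · rfl
  · intro i hi j hj hij h
    have hne : ∀ k, toPoly δ (c k • t δ ^ (k : ℕ)) ≠ 0 → c k ≠ 0 := by
      intro k hk h0
      rw [h0, zero_smul, map_zero] at hk
      exact hk rfl
    have h1 := degree_smul_t_pow hδ (hne i hi.2) i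
    have h2 := degree_smul_t_pow hδ (hne j hj.2) j
    have h3 : (c i • t δ ^ (i : ℕ)).degree = (c j • t δ ^ (j : ℕ)).degree := h
    rw [h1, h2] at h3
    have h4 : order δ * (c i).natDegree + i = order δ * (c j).natDegree + j := by exact_mod_cast h3
    have h5 := congrArg (· % order δ) h4
    simp only [Nat.mul_add_mod, Nat.mod_eq_of_lt i.2, Nat.mod_eq_of_lt j.2] at h5
    exact hij (Fin.ext h5)

theorem degree_smul_t_pow_le (c : Fin (order δ) → K[X]) (i : Fin (order δ)) :
    (c i • t δ ^ (i : ℕ)).degree ≤ (∑ i, c i • t δ ^ (i : ℕ)).degree := by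
  rw [degree_sum_smul_t_pow hδ]
  exact Finset.le_sup (f := fun i => (c i • t δ ^ (i : ℕ)).degree) (Finset.mem_univ i)

theorem linearIndependent_t_pow :
    LinearIndependent K[X] fun i : Fin (order δ) => t δ ^ (i : ℕ) := by
  rw [Fintype.linearIndependent_iff]
  intro c hc i
  by_contra hi
  have h := degree_smul_t_pow_le hδ c i
  rw [hc, degree_zero, degree_smul_t_pow hδ hi] at h
  exact absurd h (WithBot.bot_lt_coe _).not_ge

/-- Dividing `k` by `n` with remainder, `x ^ (k / n) * t ^ (k % n)` has degree exactly `k`; one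
element of each degree already spans over `K`. -/
theorem span_t_pow :
    Submodule.span K[X] (Set.range fun i : Fin (order δ) => t δ ^ (i : ℕ)) = ⊤ := by
  let S : Polynomial.Sequence K :=
    { elems' := fun k => toPoly δ (x δ ^ (k / order δ) * t δ ^ (k % order δ))
      degree_eq' := fun k => by
        have := degree_x_pow_mul_t_pow hδ (k / order δ) (k % order δ)
        rwa [Nat.div_add_mod] at this }
  have hS := S.span fun i => (leadingCoeff_ne_zero.mpr (S.ne_zero i)).isUnit
  rw [eq_top_iff]
  intro f _
  have hf : toPoly δ f ∈ Submodule.span K (Set.range S) := hS ▸ Submodule.mem_top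
  rw [← (toPoly δ).symm_apply_apply f]
  generalize toPoly δ f = p at hf ⊢
  induction hf using Submodule.span_induction with
  | mem p hp =>
    obtain ⟨k, rfl⟩ := hp
    change x δ ^ (k / order δ) * t δ ^ (k % order δ) ∈ _
    rw [← ofPoly_X, ← map_pow, ← smul_eq_ofPoly_mul]
    exact Submodule.smul_mem _ _
      (Submodule.subset_span ⟨⟨k % order δ, Nat.mod_lt _ (order_pos hδ)⟩, rfl⟩)
  | zero => rw [map_zero]; exact Submodule.zero_mem _
  | add p q _ _ hp hq => rw [map_add]; exact Submodule.add_mem _ hp hq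
  | smul a p _ hp =>
    have : (toPoly δ).symm (a • p) = (C a : K[X]) • (toPoly δ).symm p := by
      apply (toPoly δ).injective
      rw [C_smul, toPoly_const_mul, AddEquiv.apply_symm_apply, AddEquiv.apply_symm_apply,
        smul_eq_C_mul]
    rw [this]
    exact Submodule.smul_mem _ _ hp

/-- The powers `1, t, …, tⁿ⁻¹` are a basis of `K[t; δ]` over `K[x]`, where `n` is the degree of
the minimum polynomial of `δ`. -/
def tBasis : Module.Basis (Fin (order δ)) K[X] (DiffPoly δ) :=
  Module.Basis.mk (linearIndependent_t_pow hδ) (span_t_pow hδ).ge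

theorem tBasis_apply (i : Fin (order δ)) : tBasis hδ i = t δ ^ (i : ℕ) := by
  rw [tBasis, Module.Basis.mk_apply]

theorem degree_repr_le {f : DiffPoly δ} {m : ℕ} (hf : f.degree ≤ m) (i : Fin (order δ))
    (hi : (tBasis hδ).repr f i ≠ 0) :
    order δ * ((tBasis hδ).repr f i).natDegree + i ≤ m := by
  have h := degree_smul_t_pow_le hδ ((tBasis hδ).repr f) i
  have h2 := (tBasis hδ).sum_repr f
  simp only [tBasis_apply] at h2
  rw [degree_smul_t_pow hδ hi, h2] at h
  exact_mod_cast h.trans hf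

end DiffPoly
end

/-! ### The matrix of right multiplication and its determinant. -/

noncomputable section

namespace DiffPoly

variable {K : Type*} [Field K] {δ : Derivation ℤ K K}

/-- Right multiplication by `f`, as a `K[x]`-linear endomorphism of `K[t; δ]`. -/
def mulRight (f : DiffPoly δ) : DiffPoly δ →ₗ[K[X]] DiffPoly δ where
  toFun v := v * f
  map_add' v w := add_mul v w f
  map_smul' _ _ := mul_assoc _ _ _

theorem mulRight_apply (f v : DiffPoly δ) : mulRight f v = v * f := rfl

theorem smul_mul (p : K[X]) (v f : DiffPoly δ) : (p • v) * f = p • (v * f) := mul_assoc _ _ _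

theorem coeffDeriv_monomial (n : ℕ) (a : K) :
    coeffDeriv δ (monomial n a) = monomial n (δ a) := by
  ext k
  rw [coeff_coeffDeriv, coeff_monomial, coeff_monomial]
  split_ifs <;> simp

theorem coeffDeriv_mul (p q : K[X]) :
    coeffDeriv δ (p * q) = coeffDeriv δ p * q + p * coeffDeriv δ q := by
  induction p using Polynomial.induction_on' with
  | add p p' hp hp' => rw [add_mul, map_add, map_add, hp, hp']; ring
  | monomial n a =>
    induction q using Polynomial.induction_on' with
    | add q q' hq hq' => rw [mul_add, map_add, map_add, hq, hq']; ring
    | monomial m b =>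
      simp only [monomial_mul_monomial, coeffDeriv_monomial]
      rw [← map_add, Derivation.leibniz, smul_eq_mul, smul_eq_mul]
      congr 1
      ring

/-- `p ↦ p + δ(p) ε`, as a ring homomorphism to the dual numbers over `K[X]`. -/
def dualShift (δ : Derivation ℤ K K) : K[X] →+* DualNumber K[X] where
  toFun p := TrivSqZeroExt.inl p + TrivSqZeroExt.inr (coeffDeriv δ p)
  map_one' := by
    have : coeffDeriv δ (1 : K[X]) = 0 := by
      rw [← C_1, ← monomial_zero_left, coeffDeriv_monomial, Derivation.map_one_eq_zero, map_zero]
    rw [this]; simp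
  map_zero' := by simp
  map_add' p q := by ext <;> simp
  map_mul' p q := by
    ext
    · simp
    · simp [coeffDeriv_mul]; ring

/-- If the derivative of a matrix `M` is a commutator `[T, M]` then `det M` has derivative zero. -/
theorem coeffDeriv_det_eq_zero {n : Type*} [Fintype n] [DecidableEq n] (M T : Matrix n n K[X])
    (h : M.map (coeffDeriv δ) = T * M - M * T) : coeffDeriv δ M.det = 0 := by
  let ι : K[X] →+* DualNumber K[X] := TrivSqZeroExt.inlHom K[X] K[X]
  let ε : DualNumber K[X] := DualNumber.eps
  have hε : ε * ε = 0 := DualNumber.eps_mul_eps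
  -- Over the dual numbers `M + ε δ(M)` is the conjugate of `M` by `1 + ε T`, whose inverse is `1 -
  -- ε T` because `ε² = 0`. Equality of determinants then says that the `ε`-part of `det M + ε δ(det
  -- M)` vanishes.
  have hM : M.map (dualShift δ) = (1 + ε • T.map ι) * M.map ι * (1 - ε • T.map ι) := by
    have h1 : M.map (dualShift δ) = M.map ι + ε • (M.map (coeffDeriv δ)).map ι := by
      ext1 i j
      change dualShift δ (M i j) = ι (M i j) + ε * ι (coeffDeriv δ (M i j))
      ext <;> simp [dualShift, ε, ι]
    rw [h1, h, Matrix.map_sub _ (map_sub ι), Matrix.map_mul, Matrix.map_mul]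
    have h2 : (1 + ε • T.map ι) * M.map ι * (1 - ε • T.map ι)
        = M.map ι + ε • (T.map ι * M.map ι - M.map ι * T.map ι)
          - (ε * ε) • (T.map ι * M.map ι * T.map ι) := by
      rw [mul_smul]
      simp only [add_mul, mul_sub, one_mul, mul_one, smul_mul_assoc, mul_smul_comm, smul_sub,
        smul_add]
      abel
    rw [h2, hε, zero_smul, sub_zero]
  have hdet : dualShift δ M.det = ι M.det := by
    have h1 : (dualShift δ) M.det = (M.map (dualShift δ)).det := (dualShift δ).map_det M
    have h2 : ι M.det = (M.map ι).det := ι.map_det M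
    rw [h1, h2, hM, Matrix.det_mul, Matrix.det_mul, mul_right_comm, ← Matrix.det_mul]
    have : (1 + ε • T.map ι) * (1 - ε • T.map ι) = 1 := by
      have h3 : (1 + ε • T.map ι) * (1 - ε • T.map ι) = 1 - (ε * ε) • (T.map ι * T.map ι) := by
        rw [mul_smul]
        simp only [add_mul, mul_sub, one_mul, mul_one, smul_mul_assoc, mul_smul_comm, smul_add]
        abel
      rw [h3, hε, zero_smul, sub_zero]
    rw [this, Matrix.det_one, one_mul]
  have := congrArg TrivSqZeroExt.snd hdet
  simpa [dualShift, ι] using this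

theorem exists_map_eq_of_coeffDeriv_eq_zero {p : K[X]} (hp : coeffDeriv δ p = 0) :
    ∃ q : (Const δ)[X], q.map (Const δ).subtype = p := by
  rw [← Polynomial.mem_lifts, Polynomial.lifts_iff_coeff_lifts]
  intro n
  refine ⟨⟨p.coeff n, ?_⟩, rfl⟩
  change δ _ = 0
  rw [← coeff_coeffDeriv, hp, coeff_zero]

/-- As `x` commutes with `t`, the commutator of `t` with an element of `K[x]` differentiates only
its coefficients. -/
theorem t_mul_smul (p : K[X]) (v : DiffPoly δ) :
    t δ * (p • v) = p • (t δ * v) + coeffDeriv δ p • v := by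
  induction p using Polynomial.induction_on' with
  | add p q hp hq =>
    rw [add_smul, mul_add, hp, hq, map_add, add_smul, add_smul]
    abel
  | monomial n a =>
    rw [coeffDeriv_monomial, ← C_mul_X_pow_eq_monomial, ← C_mul_X_pow_eq_monomial]
    simp only [smul_eq_ofPoly_mul, map_mul, map_pow, ofPoly_C, ofPoly_X]
    have hx : t δ * x δ ^ n = x δ ^ n * t δ := ((x_commute δ (t δ)).pow_left n).eq.symm
    rw [← mul_assoc, ← mul_assoc, t_mul_const, add_mul, mul_assoc (const δ a), hx]
    noncomm_ring

variable (hδ : IsIntegral (Const δ) (derivEnd δ))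

/-- The matrix of right multiplication by `f` in the basis `1, t, …, tⁿ⁻¹`, with the coordinates of
`tⁱ f` in row `i`. -/
def matrix : DiffPoly δ →+* Matrix (Fin (order δ)) (Fin (order δ)) K[X] where
  -- Right multiplications compose in reverse order; the transpose restores the order and makes the
  -- map a ring homomorphism.
  toFun f := (LinearMap.toMatrix (tBasis hδ) (tBasis hδ) (mulRight f)).transpose
  map_one' := by
    have : mulRight (1 : DiffPoly δ) = LinearMap.id := LinearMap.ext fun v => mul_one v
    rw [this, LinearMap.toMatrix_id, Matrix.transpose_one]
  map_zero' := by
    have : mulRight (0 : DiffPoly δ) = 0 := LinearMap.ext fun v => mul_zero v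
    rw [this, map_zero, Matrix.transpose_zero]
  map_add' f g := by
    have : mulRight (f + g) = mulRight f + mulRight g := LinearMap.ext fun v => mul_add v f g
    rw [this, map_add, Matrix.transpose_add]
  map_mul' f g := by
    have : mulRight (f * g) = mulRight g ∘ₗ mulRight f :=
      LinearMap.ext fun v => (mul_assoc v f g).symm
    rw [this, LinearMap.toMatrix_comp _ (tBasis hδ), Matrix.transpose_mul]

theorem matrix_apply (f : DiffPoly δ) (i j : Fin (order δ)) :
    matrix hδ f i j = (tBasis hδ).repr (t δ ^ (i : ℕ) * f) j := by
  change LinearMap.toMatrix (tBasis hδ) (tBasis hδ) (mulRight f) j i = _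
  rw [LinearMap.toMatrix_apply, tBasis_apply, mulRight_apply]

theorem sum_matrix_smul (f : DiffPoly δ) (i : Fin (order δ)) :
    ∑ j, matrix hδ f i j • t δ ^ (j : ℕ) = t δ ^ (i : ℕ) * f := by
  simp only [matrix_apply, ← tBasis_apply hδ]
  exact (tBasis hδ).sum_repr _

theorem det_matrix (f : DiffPoly δ) : (matrix hδ f).det = LinearMap.det (mulRight f) := by
  rw [← LinearMap.det_toMatrix (tBasis hδ)]
  exact Matrix.det_transpose _

theorem matrix_algebraMap (p : (Const δ)[X]) :
    matrix hδ (algebraMap (Const δ)[X] (DiffPoly δ) p) =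
      Matrix.scalar _ (p.map (Const δ).subtype) := by
  ext i j : 2
  rw [matrix_apply, ← Algebra.commutes, ← ofPoly_map, ← smul_eq_ofPoly_mul, ← tBasis_apply hδ,
    map_smul, Module.Basis.repr_self, Finsupp.smul_single, Matrix.scalar_apply,
    Matrix.diagonal_apply, Finsupp.single_apply, smul_eq_mul, mul_one]

/-- Write `tⁱ f = ∑ⱼ Mᵢⱼ tʲ`. Then `tⁱ (t f - f t)` is the commutator of `t` with this sum, namely
`∑ⱼ δ(Mᵢⱼ) tʲ`. -/
theorem matrix_commutator (f : DiffPoly δ) :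
    (matrix hδ f).map (coeffDeriv δ) =
      matrix hδ (t δ) * matrix hδ f - matrix hδ f * matrix hδ (t δ) := by
  rw [← map_mul, ← map_mul, ← map_sub]
  ext i k : 2
  rw [matrix_apply]
  have h : t δ ^ (i : ℕ) * (t δ * f - f * t δ)
      = ∑ j, coeffDeriv δ (matrix hδ f i j) • t δ ^ (j : ℕ) := by
    rw [mul_sub, ← mul_assoc, ← mul_assoc, ← pow_succ, pow_succ', mul_assoc, ← sum_matrix_smul hδ,
      Finset.mul_sum, Finset.sum_mul, ← Finset.sum_sub_distrib]
    refine Finset.sum_congr rfl fun j _ => ?_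
    rw [t_mul_smul, smul_mul, ← pow_succ, ← pow_succ', add_sub_cancel_left]
  rw [h]
  simp only [← tBasis_apply hδ]
  rw [Module.Basis.repr_sum_self, Matrix.map_apply]

theorem exists_map_eq_det_matrix (f : DiffPoly δ) :
    ∃ q : (Const δ)[X], q.map (Const δ).subtype = (matrix hδ f).det :=
  exists_map_eq_of_coeffDeriv_eq_zero (coeffDeriv_det_eq_zero _ _ (matrix_commutator hδ f))

/-- The determinant of `matrix hδ f`, as a polynomial over the field of constants. -/
def polyNorm (f : DiffPoly δ) : (Const δ)[X] := (exists_map_eq_det_matrix hδ f).choose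

theorem map_polyNorm (f : DiffPoly δ) :
    (polyNorm hδ f).map (Const δ).subtype = (matrix hδ f).det :=
  (exists_map_eq_det_matrix hδ f).choose_spec

theorem polyNorm_mul (f g : DiffPoly δ) : polyNorm hδ (f * g) = polyNorm hδ f * polyNorm hδ g := by
  apply Polynomial.map_injective _ (Const δ).subtype_injective
  rw [Polynomial.map_mul, map_polyNorm, map_polyNorm, map_polyNorm, map_mul, Matrix.det_mul]

theorem polyNorm_algebraMap (p : (Const δ)[X]) :
    polyNorm hδ (algebraMap (Const δ)[X] (DiffPoly δ) p) = p ^ order δ := by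
  apply Polynomial.map_injective _ (Const δ).subtype_injective
  rw [map_polyNorm, matrix_algebraMap, Matrix.scalar_apply, Matrix.det_diagonal, Finset.prod_const,
    Finset.card_univ, Fintype.card_fin, Polynomial.map_pow]

/-- A unit determinant makes right multiplication by `f` surjective, so some `v` has `v f = 1`. -/
theorem isUnit_of_isUnit_polyNorm {f : DiffPoly δ} (h : IsUnit (polyNorm hδ f)) : IsUnit f := by
  have hdet : IsUnit (LinearMap.det (mulRight f)) := by
    rw [← det_matrix hδ, ← map_polyNorm]
    exact h.map (mapRingHom (Const δ).subtype)
  have := Module.Free.of_basis (tBasis hδ)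
  have := Module.Finite.of_basis (tBasis hδ)
  obtain ⟨v, hv⟩ := ((Module.End.isUnit_iff _).mp
    ((LinearMap.isUnit_iff_isUnit_det _).mpr hdet)).surjective 1
  exact isUnit_of_mul_eq_one_left hv

/-- A nonzero entry in row `i` and column `j` satisfies `n · deg + j ≤ i + m`. Summed along a
permutation, the row and column indices cancel and leave `n · deg ≤ n · m` for each term of the
determinant. -/
theorem natDegree_polyNorm_le {f : DiffPoly δ} {m : ℕ} (hf : f.degree = m) :
    (polyNorm hδ f).natDegree ≤ m := by
  rw [← natDegree_map_eq_of_injective (Const δ).subtype_injective, map_polyNorm, Matrix.det_apply]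
  refine natDegree_sum_le_of_forall_le _ _ fun σ _ => ?_
  rw [Units.smul_def, zsmul_eq_mul]
  refine (natDegree_mul_le).trans ?_
  rw [natDegree_intCast, zero_add]
  by_cases h0 : ∏ i, matrix hδ f (σ i) i = 0
  · rw [h0, natDegree_zero]
    exact Nat.zero_le m
  have h0' := Finset.prod_ne_zero_iff.mp h0
  rw [natDegree_prod _ _ h0']
  have key : ∀ i : Fin (order δ),
      order δ * (matrix hδ f (σ i) i).natDegree + i ≤ (σ i : ℕ) + m := by
    intro i
    have hi := h0' i (Finset.mem_univ i)
    rw [matrix_apply] at hi ⊢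
    refine degree_repr_le hδ ?_ i hi
    rw [degree_mul, degree_t_pow, hf]
    norm_cast
  have hsum := Finset.sum_le_sum fun i (_ : i ∈ Finset.univ) => key i
  rw [Finset.sum_add_distrib, Finset.sum_add_distrib, ← Finset.mul_sum,
    Equiv.sum_comp σ fun i => (i : ℕ), Finset.sum_const, Finset.card_univ, Fintype.card_fin,
    smul_eq_mul, add_comm (∑ i : Fin (order δ), (i : ℕ))] at hsum
  exact Nat.le_of_mul_le_mul_left (Nat.le_of_add_le_add_right hsum) (order_pos hδ)

end DiffPoly
end

/-! ### Divisibility between the norm and the minimal central left multiple. -/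

noncomputable section

namespace DiffPoly

variable {K : Type*} [Field K] {δ : Derivation ℤ K K} (hδ : IsIntegral (Const δ) (derivEnd δ))

include hδ

theorem degree_algebraMap {c : (Const δ)[X]} (hc : c ≠ 0) :
    (algebraMap (Const δ)[X] (DiffPoly δ) c).degree
      = ((order δ * c.natDegree : ℕ) : WithBot ℕ) := by
  rw [← ofPoly_map, degree_ofPoly hδ, natDegree_map_eq_of_injective (Const δ).subtype_injective]
  rwa [Ne, Polynomial.map_eq_zero]

omit hδ in
theorem algebraMap_mem_center (c : (Const δ)[X]) :
    algebraMap (Const δ)[X] (DiffPoly δ) c ∈ Subring.center (DiffPoly δ) :=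
  Subring.mem_center_iff.mpr fun g => (Algebra.commutes c g).symm

/-- The degree in `x` of a minimal central left multiple is minimal. -/
theorem IsMinimalCentralLeftMultiple.natDegree_le {f : DiffPoly δ} {h : (Const δ)[X]}
    (hh : f.IsMinimalCentralLeftMultiple h) {c : (Const δ)[X]} (hc : c ≠ 0)
    (hcf : ∃ q : DiffPoly δ, algebraMap (Const δ)[X] (DiffPoly δ) c = q * f) :
    h.natDegree ≤ c.natDegree := by
  have hc0 : algebraMap (Const δ)[X] (DiffPoly δ) c ≠ 0 := by
    intro h0
    have := degree_algebraMap hδ hc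
    rw [h0, degree_zero] at this
    exact WithBot.bot_ne_coe this
  have := hh.degree_le _ (algebraMap_mem_center c) hc0 hcf
  rw [degree_algebraMap hδ hc, degree_algebraMap hδ hh.monic.ne_zero] at this
  exact Nat.le_of_mul_le_mul_left (by exact_mod_cast this) (order_pos hδ)

theorem IsMinimalCentralLeftMultiple.irreducible {f : DiffPoly δ} {h : (Const δ)[X]}
    (hh : f.IsMinimalCentralLeftMultiple h) (hf : Irreducible f) : Irreducible h := by
  obtain ⟨q, hq⟩ := hh.isLeftMultiple
  refine ⟨fun hu => ?_, fun {a b} hab => ?_⟩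
  · obtain ⟨u, hu⟩ := hu.map (algebraMap (Const δ)[X] (DiffPoly δ))
    refine hf.not_isUnit (isUnit_of_mul_eq_one_left (v := ↑u⁻¹ * q) ?_)
    rw [mul_assoc, ← hq, ← hu, Units.inv_mul]
  have hab0 : a * b ≠ 0 := hab ▸ hh.monic.ne_zero
  have ha0 := left_ne_zero_of_mul hab0
  have hb0 := right_ne_zero_of_mul hab0
  have hdeg : h.natDegree = a.natDegree + b.natDegree := by rw [hab, natDegree_mul ha0 hb0]
  by_cases ha : ∃ q, algebraMap (Const δ)[X] (DiffPoly δ) a = q * f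
  · have := hh.natDegree_le hδ ha0 ha
    exact Or.inr (isUnit_iff_degree_eq_zero.mpr (by
      rw [degree_eq_natDegree hb0]
      exact_mod_cast (by omega : b.natDegree = 0)))
  · obtain ⟨u, v, huv⟩ := exists_bezout_of_irreducible hf ha
    -- If `a ∉ Rf`, then `u f + v a = 1`. Multiplying by the central `b` gives `b = b u f + v (a
    -- b)`, where `a b = ĥ = q f`.
    have hb : algebraMap (Const δ)[X] (DiffPoly δ) b
        = (algebraMap (Const δ)[X] (DiffPoly δ) b * u + v * q) * f := by
      rw [add_mul, mul_assoc v, ← hq, hab, map_mul, mul_assoc, ← mul_assoc v,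
        ← Algebra.commutes b (v * _), ← mul_add, huv, mul_one]
    have := hh.natDegree_le hδ hb0 ⟨_, hb⟩
    exact Or.inl (isUnit_iff_degree_eq_zero.mpr (by
      rw [degree_eq_natDegree ha0]
      exact_mod_cast (by omega : a.natDegree = 0)))

/-- The norm of a nonunit dividing a power of the prime `h` is divisible by `h`. -/
theorem dvd_polyNorm_of_dvd_pow {a : DiffPoly δ} (ha : ¬ IsUnit a) {h : (Const δ)[X]}
    (hirr : Irreducible h) {n : ℕ} (hdvd : polyNorm hδ a ∣ h ^ n) :
    h ∣ polyNorm hδ a := by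
  obtain ⟨i, -, hi⟩ := (dvd_prime_pow hirr.prime n).mp hdvd
  rcases Nat.eq_zero_or_pos i with rfl | hi0
  · rw [pow_zero, associated_one_iff_isUnit] at hi
    exact absurd (isUnit_of_isUnit_polyNorm hδ hi) ha
  · exact (dvd_pow_self h hi0.ne').trans hi.symm.dvd

theorem IsMinimalCentralLeftMultiple.polyNorm_dvd_pow {f : DiffPoly δ} {h : (Const δ)[X]}
    (hh : f.IsMinimalCentralLeftMultiple h) : polyNorm hδ f ∣ h ^ order δ := by
  obtain ⟨q, hq⟩ := hh.isLeftMultiple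
  rw [← polyNorm_algebraMap hδ, hq, polyNorm_mul]
  exact dvd_mul_left _ _

theorem IsMinimalCentralLeftMultiple.irreducible_of_irreducible {f : DiffPoly δ} {m : ℕ}
    (hf : f.degree = m) {h : (Const δ)[X]} (hh : f.IsMinimalCentralLeftMultiple h)
    (hm : h.natDegree = m) (hirr : Irreducible h) : Irreducible f := by
  have hpos := hirr.natDegree_pos
  refine ⟨fun hu => ?_, fun {a b} hab => ?_⟩
  · obtain ⟨u, rfl⟩ := hu
    have := hh.natDegree_le hδ one_ne_zero ⟨↑u⁻¹, by rw [map_one, Units.inv_mul]⟩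
    rw [natDegree_one] at this
    omega
  by_contra! hnu
  have hdvd := hh.polyNorm_dvd_pow hδ
  have hN0 : polyNorm hδ f ≠ 0 := ne_zero_of_dvd_ne_zero (pow_ne_zero _ hirr.ne_zero) hdvd
  have hle := natDegree_polyNorm_le hδ hf
  rw [hab, polyNorm_mul] at hdvd hN0 hle
  -- Both factors are nonunits, so `ĥ` divides each norm; then `2m ≤ deg N(f) ≤ m`, impossible for
  -- `m > 0`.
  have h2 : h * h ∣ polyNorm hδ a * polyNorm hδ b := mul_dvd_mul
    (dvd_polyNorm_of_dvd_pow hδ hnu.1 hirr ((dvd_mul_right _ _).trans hdvd))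
    (dvd_polyNorm_of_dvd_pow hδ hnu.2 hirr ((dvd_mul_left _ _).trans hdvd))
  have h3 := natDegree_le_of_dvd h2 hN0
  rw [natDegree_mul hirr.ne_zero hirr.ne_zero] at h3
  omega

theorem IsMinimalCentralLeftMultiple.irreducible_polyNorm {f : DiffPoly δ} {m : ℕ}
    (hf : f.degree = m) {h : (Const δ)[X]} (hh : f.IsMinimalCentralLeftMultiple h)
    (hm : h.natDegree = m) (hirr : Irreducible f) : Irreducible (polyNorm hδ f) := by
  have hirr' := hh.irreducible hδ hirr
  have hdvd := hh.polyNorm_dvd_pow hδ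
  have hN0 : polyNorm hδ f ≠ 0 := ne_zero_of_dvd_ne_zero (pow_ne_zero _ hirr'.ne_zero) hdvd
  have hass : Associated h (polyNorm hδ f) := by
    refine associated_of_dvd_of_natDegree_le
      (dvd_polyNorm_of_dvd_pow hδ hirr.not_isUnit hirr' hdvd) hN0 ?_
    rw [hm]
    exact natDegree_polyNorm_le hδ hf
  exact hass.irreducible_iff.mp hirr'

end DiffPoly
end

/-! ### Jets and the degree of `K` over its constants. -/

noncomputable section

namespace DiffPoly

variable {K : Type*} [Field K] {δ : Derivation ℤ K K}

variable (δ) in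
/-- The vector `(a, δ a, …, δⁿ⁻¹ a)`. -/
def jet (a : K) : Fin (order δ) → K := fun l => (derivEnd δ ^ (l : ℕ)) a

/-- A functional killing every jet is a differential operator of order less than `n` that vanishes
on `K`; its coefficients are zero by minimality of `g`. -/
theorem span_jet : Submodule.span K (Set.range (jet δ)) = ⊤ := by
  by_contra h
  obtain ⟨φ, hφ0, hle⟩ := Submodule.exists_le_ker_of_lt_top _ (lt_top_iff_ne_top.mpr h)
  set f : K[X] := ∑ l : Fin (order δ), monomial (l : ℕ) (φ (Pi.single l 1)) with hf
  have hφ : ∀ v : Fin (order δ) → K, φ v = ∑ l, φ (Pi.single l 1) * v l := by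
    intro v
    conv_lhs => rw [pi_eq_sum_univ' v, map_sum]
    refine Finset.sum_congr rfl fun l _ => ?_
    rw [map_smul, smul_eq_mul, mul_comm]
  have hf0 : f = 0 := by
    refine eq_zero_of_diffOp_eq_zero δ f (fun y => ?_) ?_
    · have h1 : diffOp δ f y = φ (jet δ y) := by
        rw [hφ, hf]
        induction (Finset.univ : Finset (Fin (order δ))) using Finset.induction_on with
        | empty => simp [diffOp]
        | insert l s hl ih =>
          rw [Finset.sum_insert hl, Finset.sum_insert hl, diffOp_add, ih, diffOp_monomial]
          rfl
      rw [h1]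
      exact hle (Submodule.subset_span ⟨y, rfl⟩)
    -- Integrality of `δ` is not assumed here, so `minpoly` may be the default `0`; then `order δ =
    -- 0` and the space of jets is trivial.
    · rcases Nat.eq_zero_or_pos (order δ) with h0 | hpos
      · have : IsEmpty (Fin (order δ)) := by rw [h0]; infer_instance
        exact absurd (LinearMap.ext fun v => by rw [hφ]; simp) hφ0
      · have hg0 : minpoly (Const δ) (derivEnd δ) ≠ 0 := by
          intro h0
          rw [order, h0, natDegree_zero] at hpos
          exact hpos.false
        rw [degree_eq_natDegree hg0, ← mem_degreeLT]
        refine Submodule.sum_mem _ fun l _ => ?_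
        rw [mem_degreeLT]
        exact (degree_monomial_le _ _).trans_lt (by exact_mod_cast l.2)
  refine hφ0 (LinearMap.ext fun v => ?_)
  rw [hφ, LinearMap.zero_apply]
  refine Finset.sum_eq_zero fun l _ => ?_
  have := congrArg (fun p => p.coeff (l : ℕ)) hf0
  simp only [hf, finsetSum_coeff, coeff_monomial, coeff_zero, Fin.val_inj, Finset.sum_ite_eq',
    Finset.mem_univ, if_true] at this
  rw [this, zero_mul]

variable (hδ : IsIntegral (Const δ) (derivEnd δ))

include hδ

/-- A `K`-linear relation between the jets of `b` and `a₁, …, aₙ` extends by one derivative. -/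
theorem pow_eq_sum_of_jet_eq_sum {N : ℕ} {a : Fin N → K} {b : K} {c : Fin N → K}
    (h : jet δ b = ∑ s, c s • jet δ (a s)) (l : ℕ) (hl : l ≤ order δ) :
    (derivEnd δ ^ l) b = ∑ s, c s * (derivEnd δ ^ l) (a s) := by
  have hlt : ∀ l < order δ, (derivEnd δ ^ l) b = ∑ s, c s * (derivEnd δ ^ l) (a s) := by
    intro l hl
    have := congrFun h ⟨l, hl⟩
    rwa [Finset.sum_apply] at this
  rcases hl.lt_or_eq with hl | rfl
  · exact hlt l hl
  set g := minpoly (Const δ) (derivEnd δ) with hg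
  -- The relation `g(δ) = 0` expresses `δⁿ y` by lower derivatives, with coefficients that do not
  -- depend on `y`.
  have hrec : ∀ y, (derivEnd δ ^ order δ) y
      = -∑ k ∈ Finset.range (order δ), (g.coeff k : K) * (derivEnd δ ^ k) y := by
    intro y
    have h0 : aeval (derivEnd δ) g y = 0 := by rw [hg, minpoly.aeval]; rfl
    have hmon : g.Monic := minpoly.monic hδ
    rw [hmon.as_sum, map_add, map_sum, LinearMap.add_apply, LinearMap.sum_apply,
      aeval_X_pow] at h0
    rw [eq_neg_iff_add_eq_zero, ← h0]
    congr 1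
    refine Finset.sum_congr rfl fun k _ => ?_
    rw [← smul_eq_C_mul, map_smul, aeval_X_pow]
    rfl
  rw [hrec, Finset.sum_congr rfl fun k hk => by rw [hlt k (Finset.mem_range.mp hk)]]
  simp only [hrec, mul_neg, Finset.sum_neg_distrib, Finset.mul_sum]
  rw [Finset.sum_comm]
  exact congrArg _ (Finset.sum_congr rfl fun s _ => Finset.sum_congr rfl fun k _ => by ring)

/-- `K` is spanned over its field of constants by as many elements as the degree of the minimum
polynomial of `δ`. -/
theorem exists_span_const_eq_top :
    ∃ a : Fin (order δ) → K, Submodule.span (Const δ) (Set.range a) = ⊤ := by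
  have hfin : Module.finrank K (Submodule.span K (Set.range (jet δ))) = order δ := by
    rw [span_jet, finrank_top, Module.finrank_fin_fun]
  suffices H : ∃ N, N = order δ ∧
      ∃ a : Fin N → K, Submodule.span (Const δ) (Set.range a) = ⊤ by
    obtain ⟨_, rfl, h⟩ := H
    exact h
  obtain ⟨v, hv, hvs, hvi⟩ := Submodule.exists_fun_fin_finrank_span_eq K (Set.range (jet δ))
  choose a ha using hv
  obtain rfl : v = fun s => jet δ (a s) := funext fun s => (ha s).symm
  refine ⟨_, hfin, a, eq_top_iff.mpr fun b _ => ?_⟩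
  have hb : jet δ b ∈ Submodule.span K (Set.range fun s => jet δ (a s)) := by
    rw [hvs, span_jet]
    exact Submodule.mem_top
  obtain ⟨c, hc⟩ := (Submodule.mem_span_range_iff_exists_fun K).mp hb
  have hpow := pow_eq_sum_of_jet_eq_sum hδ hc.symm
  -- Differentiate `δˡ b = ∑ cₛ δˡ aₛ` and subtract the relation at `l + 1 ≤ n`: this leaves `∑
  -- δ(cₛ) δˡ aₛ = 0` for all `l < n`, and the jets of the `aₛ` are independent.
  have hδc : ∀ s, δ (c s) = 0 := by
    refine Fintype.linearIndependent_iff.mp hvi (fun s => δ (c s)) (funext fun l => ?_)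
    have h1 : (derivEnd δ ^ ((l : ℕ) + 1)) b = δ ((derivEnd δ ^ (l : ℕ)) b) := by
      rw [pow_succ']; rfl
    rw [hpow _ l.2, hpow _ l.2.le, map_sum] at h1
    rw [Finset.sum_apply, Pi.zero_apply]
    have h2 : ∀ s, δ (c s * (derivEnd δ ^ (l : ℕ)) (a s))
        = c s * (derivEnd δ ^ ((l : ℕ) + 1)) (a s) + δ (c s) * (derivEnd δ ^ (l : ℕ)) (a s) := by
      intro s
      rw [Derivation.leibniz, pow_succ', smul_eq_mul, smul_eq_mul, mul_comm (δ (c s))]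
      rfl
    simp only [h2, Finset.sum_add_distrib] at h1
    exact left_eq_add.mp h1
  have h0 := hpow 0 (Nat.zero_le _)
  simp only [pow_zero, Module.End.one_apply] at h0
  rw [h0]
  exact Submodule.sum_mem _ fun s _ =>
    Submodule.smul_mem _ (⟨c s, hδc s⟩ : Const δ) (Submodule.subset_span ⟨s, rfl⟩)

/-! ### The matrices of constants, and generation of the full matrix algebra. -/

omit hδ in
theorem tMul_pow_C (i : ℕ) (a : K) : (tMul δ ^ i) (C a)
    = ∑ k ∈ Finset.range (i + 1), C ((i.choose k : K) * (derivEnd δ ^ (i - k)) a) * X ^ k := by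
  let A : AddMonoid.End K[X] := AddMonoidHom.mulLeft X
  let B : AddMonoid.End K[X] := coeffDeriv δ
  -- Multiplication by `X` and coefficientwise `δ` commute, so the binomial theorem applies to
  -- powers of their sum `tMul δ`.
  have hcomm : Commute A B := by
    refine AddMonoidHom.ext fun p => ?_
    change X * coeffDeriv δ p = coeffDeriv δ (X * p)
    ext n
    cases n <;> simp [coeff_coeffDeriv]
  have hB : ∀ k, (B ^ k) (C a) = C ((derivEnd δ ^ k) a) := by
    intro k
    induction k with
    | zero => rfl
    | succ k ih =>
      rw [pow_succ', pow_succ']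
      change coeffDeriv δ ((B ^ k) (C a)) = C (δ _)
      rw [ih, ← monomial_zero_left, coeffDeriv_monomial]
      rfl
  have hA : ∀ (k : ℕ) (p : K[X]), (A ^ k) p = X ^ k * p := by
    intro k p
    induction k with
    | zero => rw [pow_zero, pow_zero, one_mul]; rfl
    | succ k ih =>
      rw [pow_succ', pow_succ', mul_assoc, ← ih]
      rfl
  have hAB : tMul δ = A + B := rfl
  rw [hAB, hcomm.add_pow]
  refine (AddMonoidHom.finsetSum_apply _ _ _).trans (Finset.sum_congr rfl fun k _ => ?_)
  change (A ^ k) ((B ^ (i - k)) ((i.choose k : AddMonoid.End K[X]) (C a))) = _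
  rw [AddMonoid.End.natCast_apply, map_nsmul, map_nsmul, hB, hA, nsmul_eq_mul, C_mul, map_natCast]
  ring

theorem matrix_const (a : K) (i j : Fin (order δ)) :
    matrix hδ (const δ a) i j
      = C (((i : ℕ).choose j : K) * (derivEnd δ ^ ((i : ℕ) - j)) a) := by
  have htp : toPoly δ (t δ ^ (i : ℕ) * const δ a) = (tMul δ ^ (i : ℕ)) (C a) := by
    generalize (i : ℕ) = k
    induction k with
    | zero => rw [pow_zero, one_mul]; rfl
    | succ k ih => rw [pow_succ', mul_assoc, toPoly_t_mul, ih, tMul_pow_succ]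
  have h : t δ ^ (i : ℕ) * const δ a = ∑ k : Fin (order δ),
      (C (((i : ℕ).choose k : K) * (derivEnd δ ^ ((i : ℕ) - k)) a) : K[X]) • tBasis hδ k := by
    apply (toPoly δ).injective
    simp only [map_sum, C_smul, toPoly_const_mul, tBasis_apply, toPoly_t_pow]
    rw [htp, tMul_pow_C, Fin.sum_univ_eq_sum_range fun k : ℕ =>
      C (((i : ℕ).choose k : K) * (derivEnd δ ^ ((i : ℕ) - k)) a) * (X : K[X]) ^ k]
    refine Finset.sum_subset (Finset.range_subset_range.mpr i.2) fun k _ hk => ?_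
    rw [Nat.choose_eq_zero_of_lt (by simpa using hk)]
    simp
  rw [matrix_apply, h, Module.Basis.repr_sum_self]

theorem matrix_t_pow_zero (k j : Fin (order δ)) :
    matrix hδ (t δ ^ (k : ℕ)) ⟨0, order_pos hδ⟩ j = if k = j then 1 else 0 := by
  rw [matrix_apply, pow_zero, one_mul, ← tBasis_apply hδ, Module.Basis.repr_self,
    Finsupp.single_apply]

section Splitting

variable {Ω : Type*} [Field Ω] (ι : K[X] →+* Ω)
  (S : Subalgebra Ω (Matrix (Fin (order δ)) (Fin (order δ)) Ω))
  (hS : ∀ f, (matrix hδ f).map ι ∈ S)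

include hS

/-- Row `0` of the matrix of `tᵏ` is the `k`-th unit vector, so right multiplication by it moves a
matrix unit from column `0` to column `k`. -/
theorem single_mem_of_single_zero_mem {l : Fin (order δ)}
    (hl : Matrix.single l ⟨0, order_pos hδ⟩ 1 ∈ S) (k : Fin (order δ)) :
    Matrix.single l k 1 ∈ S := by
  convert S.mul_mem hl (hS (t δ ^ (k : ℕ))) using 1
  ext i j
  rw [Matrix.mul_apply, Finset.sum_eq_single ⟨0, order_pos hδ⟩]
  · rw [Matrix.map_apply, matrix_t_pow_zero, Matrix.single_apply, Matrix.single_apply]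
    by_cases h1 : l = i <;> by_cases h2 : k = j <;> simp [h1, h2]
  · intro b _ hb
    rw [Matrix.single_apply, if_neg (fun h => hb h.2.symm), zero_mul]
  · simp

/-- For `w` the jet of `a` this is the matrix of the constant `a`. The condition is stable under
linear combinations, scalars acting through `ι`, and jets span. For `i < j` the truncated `i - j` is
harmless because the binomial coefficient is zero. -/
theorem of_choose_mul_mem (w : Fin (order δ) → K) :
    (Matrix.of fun i j : Fin (order δ) => ((i : ℕ).choose j : Ω) *
      ι (C (w ⟨i - j, (Nat.sub_le _ _).trans_lt i.2⟩))) ∈ S := by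
  have hw : w ∈ Submodule.span K (Set.range (jet δ)) := by
    rw [span_jet]
    exact Submodule.mem_top
  induction hw using Submodule.span_induction with
  | mem w hw =>
    obtain ⟨a, rfl⟩ := hw
    convert hS (const δ a) using 1
    ext i j
    rw [Matrix.map_apply, matrix_const]
    simp [jet]
  | zero =>
    convert S.zero_mem using 1
    ext i j
    simp
  | add v w _ _ hv hw =>
    convert S.add_mem hv hw using 1
    ext i j
    simp [mul_add]
  | smul a w _ hw =>
    convert S.smul_mem hw (ι (C a)) using 1
    ext i j
    simp [mul_left_comm]

omit hδ hS in
theorem mem_of_forall_single_mem (M : Matrix (Fin (order δ)) (Fin (order δ)) Ω)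
    (h : ∀ i j, M i j = 0 ∨ Matrix.single i j 1 ∈ S) : M ∈ S := by
  rw [Matrix.matrix_eq_sum_single M]
  refine S.sum_mem fun i _ => S.sum_mem fun j _ => ?_
  rcases h i j with h | h
  · rw [h, Matrix.single_zero]
    exact S.zero_mem
  · have := S.smul_mem h (M i j)
    rwa [Matrix.smul_single, smul_eq_mul, mul_one] at this

/-- Descending induction on the row `l`: the previous matrix for the `l`-th unit vector agrees with
the matrix unit at `(l, 0)` in all rows up to `l`, and every matrix unit in a lower row (index above
`l`) is already in `S`. -/
theorem single_zero_mem (l : Fin (order δ)) : Matrix.single l ⟨0, order_pos hδ⟩ 1 ∈ S := by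
  induction hd : order δ - l using Nat.strong_induction_on generalizing l with
  | _ d ih =>
    set D := Matrix.of fun i j : Fin (order δ) => ((i : ℕ).choose j : Ω) *
      ι (C ((Pi.single l 1 : Fin (order δ) → K) ⟨i - j, (Nat.sub_le _ _).trans_lt i.2⟩)) with hD
    have hDS : D ∈ S := of_choose_mul_mem hδ ι S hS (Pi.single l 1)
    have hM : D - Matrix.single l ⟨0, order_pos hδ⟩ 1 ∈ S := by
      refine mem_of_forall_single_mem S _ fun i j => ?_
      rcases lt_or_ge l i with hli | hil
      · exact Or.inr (single_mem_of_single_zero_mem hδ ι S hS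
          (ih (order δ - i) (by have := i.2; omega) i rfl) j)
      · left
        have hil' : (i : ℕ) ≤ l := hil
        rw [Matrix.sub_apply, hD, Matrix.of_apply, Matrix.single_apply, Pi.single_apply]
        rcases eq_or_lt_of_le hil with rfl | hlt
        · by_cases hj : j = ⟨0, order_pos hδ⟩
          · subst hj
            simp
          · have hj0 : (j : ℕ) ≠ 0 := fun h => hj (Fin.ext h)
            rw [if_neg fun h : i = i ∧ _ => hj h.2.symm]
            rcases lt_or_ge (i : ℕ) j with hij | hij
            · simp [Nat.choose_eq_zero_of_lt hij]
            · rw [if_neg]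
              · simp
              · intro h
                have : (i : ℕ) - j = i := congrArg Fin.val h
                omega
        · have hlt' : (i : ℕ) < l := hlt
          rw [if_neg, if_neg fun h => hlt.ne h.1.symm]
          · simp
          · intro h
            have := congrArg Fin.val h
            simp only at this
            omega
    have := S.sub_mem hDS hM
    rwa [sub_sub_cancel] at this

theorem subalgebra_eq_top : S = ⊤ := by
  rw [eq_top_iff]
  intro M _
  exact mem_of_forall_single_mem S M fun i j => Or.inr
    (single_mem_of_single_zero_mem hδ ι S hS (single_zero_mem hδ ι S hS i) j)

end Splitting

end DiffPoly
end

/-! ### Splitting `K(t; δ)` and identifying the reduced norm. -/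

noncomputable section

namespace DiffPoly

variable {K : Type*} [Field K] {δ : Derivation ℤ K K} (hδ : IsIntegral (Const δ) (derivEnd δ))

include hδ

/-- `K[t; δ]` is spanned over `F[x]` by `n²` elements. -/
theorem exists_span_eq_top : ∃ e : Fin (order δ) × Fin (order δ) → DiffPoly δ,
    Submodule.span (Const δ)[X] (Set.range e) = ⊤ := by
  obtain ⟨a, ha⟩ := exists_span_const_eq_top hδ
  refine ⟨fun s => const δ (a s.1) * t δ ^ (s.2 : ℕ), eq_top_iff.mpr fun f _ => ?_⟩
  rw [← (tBasis hδ).sum_repr f]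
  refine Submodule.sum_mem _ fun j _ => ?_
  rw [tBasis_apply]
  generalize (tBasis hδ).repr f j = p
  induction p using Polynomial.induction_on' with
  | add p q hp hq => rw [add_smul]; exact Submodule.add_mem _ hp hq
  | monomial k b =>
    rw [← C_mul_X_pow_eq_monomial, mul_comm, mul_smul]
    have hX : ∀ v : DiffPoly δ, (X ^ k : K[X]) • v = (X ^ k : (Const δ)[X]) • v := fun v => by
      rw [← map_smul_eq, Polynomial.map_pow, Polynomial.map_X]
    rw [hX]
    refine Submodule.smul_mem _ _ ?_
    have hb : b ∈ Submodule.span (Const δ) (Set.range a) := ha ▸ Submodule.mem_top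
    induction hb using Submodule.span_induction with
    | mem b hb =>
      obtain ⟨s, rfl⟩ := hb
      rw [C_smul]
      exact Submodule.subset_span ⟨(s, j), rfl⟩
    | zero => rw [C_0, zero_smul]; exact Submodule.zero_mem _
    | add b c _ _ hb hc => rw [C_add, add_smul]; exact Submodule.add_mem _ hb hc
    | smul c b _ hb =>
      have : (C (c • b) : K[X]) • t δ ^ (j : ℕ)
          = (C c : (Const δ)[X]) • ((C b : K[X]) • t δ ^ (j : ℕ)) := by
        rw [← map_smul_eq, smul_smul, Polynomial.map_C, ← C_mul]
        rfl
      rw [this]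
      exact Submodule.smul_mem _ _ hb

omit hδ in
theorem span_one_tmul_eq_top {A B M : Type*} [CommRing A] [CommRing B] [Algebra A B]
    [AddCommGroup M] [Module A M] {ι : Type*} {e : ι → M}
    (he : Submodule.span A (Set.range e) = ⊤) :
    Submodule.span B (Set.range fun i => (1 : B) ⊗ₜ[A] e i) = ⊤ := by
  rw [← Submodule.baseChange_top (R := A) (M := M) B, ← he, Submodule.baseChange_span,
    ← Set.range_comp]
  rfl

/-- `K` is finite over `F`, so it embeds over `F` in the algebraically closed field; the variable is
sent to `x`. -/
theorem exists_ringHom_algebraicClosure :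
    ∃ ι : K[X] →+* AlgebraicClosure (RatFunc (Const δ)), ∀ p : (Const δ)[X],
      ι (p.map (Const δ).subtype)
        = algebraMap (Const δ)[X] (AlgebraicClosure (RatFunc (Const δ))) p := by
  obtain ⟨a, ha⟩ := exists_span_const_eq_top hδ
  have : Module.Finite (Const δ) K :=
    ⟨Submodule.fg_def.mpr ⟨_, Set.finite_range a, ha⟩⟩
  let ι₀ : K →ₐ[Const δ] AlgebraicClosure (RatFunc (Const δ)) := IsAlgClosed.lift
  refine ⟨eval₂RingHom (ι₀ : K →+* _) (algebraMap (Const δ)[X] _ X), fun p => ?_⟩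
  rw [coe_eval₂RingHom, eval₂_map]
  have h : ((ι₀ : K →+* _).comp (Const δ).subtype)
      = (algebraMap (Const δ)[X] (AlgebraicClosure (RatFunc (Const δ)))).comp C := by
    ext c
    refine (ι₀.commutes c).trans ?_
    rw [IsScalarTower.algebraMap_apply (Const δ) (Const δ)[X]]
    rfl
  rw [h, ← hom_eval₂, eval₂_C_X]

/-- `K(t; δ)` is split by the algebraic closure of `F(x)`, through `matrix`. -/
theorem exists_splitting (ι : K[X] →+* AlgebraicClosure (RatFunc (Const δ)))
    (hι : ∀ p : (Const δ)[X], ι (p.map (Const δ).subtype)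
      = algebraMap (Const δ)[X] (AlgebraicClosure (RatFunc (Const δ))) p) :
    ∃ φ : AlgebraicClosure (RatFunc (Const δ)) ⊗[RatFunc (Const δ)] CentralQuot δ
        ≃ₐ[AlgebraicClosure (RatFunc (Const δ))]
        Matrix (Fin (order δ)) (Fin (order δ)) (AlgebraicClosure (RatFunc (Const δ))),
      ∀ f : DiffPoly δ, φ (1 ⊗ₜ (1 ⊗ₜ f)) = (matrix hδ f).map ι := by
  let Ω := AlgebraicClosure (RatFunc (Const δ))
  let M := Matrix (Fin (order δ)) (Fin (order δ)) Ω
  let ψ₀ : DiffPoly δ →ₐ[(Const δ)[X]] M :=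
    { (ι.mapMatrix).comp (matrix hδ) with
      commutes' := fun p => by
        change (matrix hδ (algebraMap (Const δ)[X] (DiffPoly δ) p)).map ι = _
        rw [matrix_algebraMap, Matrix.scalar_apply, Matrix.diagonal_map (map_zero ι),
          Matrix.algebraMap_eq_diagonal]
        congr 1
        funext i
        exact hι p }
  let ψ₁ : CentralQuot δ →ₐ[RatFunc (Const δ)] M :=
    Algebra.TensorProduct.lift (Algebra.ofId _ M) ψ₀ fun c f => Algebra.commutes c (ψ₀ f)
  let ψ : Ω ⊗[RatFunc (Const δ)] CentralQuot δ →ₐ[Ω] M :=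
    Algebra.TensorProduct.lift (Algebra.ofId _ M) ψ₁ fun c f => Algebra.commutes c (ψ₁ f)
  have hψ : ∀ f : DiffPoly δ, ψ (1 ⊗ₜ (1 ⊗ₜ f)) = (matrix hδ f).map ι := by
    intro f
    have h₁ : ψ₁ (1 ⊗ₜ f) = ψ₀ f :=
      (Algebra.TensorProduct.lift_tmul _ _ _ _ _).trans (by rw [map_one, one_mul])
    have h : ψ (1 ⊗ₜ (1 ⊗ₜ f)) = ψ₁ (1 ⊗ₜ f) :=
      (Algebra.TensorProduct.lift_tmul _ _ _ _ _).trans (by rw [map_one, one_mul])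
    rw [h, h₁]
    rfl
  have hsurj : Function.Surjective ψ := by
    rw [← AlgHom.range_eq_top]
    exact subalgebra_eq_top hδ ι ψ.range fun f => ⟨_, hψ f⟩
  obtain ⟨e, he⟩ := exists_span_eq_top hδ
  have hspan := span_one_tmul_eq_top (B := Ω) (span_one_tmul_eq_top (B := RatFunc (Const δ)) he)
  have hfin : Module.Finite Ω (Ω ⊗[RatFunc (Const δ)] CentralQuot δ) :=
    ⟨Submodule.fg_def.mpr ⟨_, Set.finite_range _, hspan⟩⟩
  -- The `n²` generators over `F[x]` still span after both base changes, so the surjection onto `n ×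
  -- n` matrices is between spaces of equal dimension.
  have hle : Module.finrank Ω (Ω ⊗[RatFunc (Const δ)] CentralQuot δ) ≤ Module.finrank Ω M := by
    have := finrank_range_le_card (R := Ω)
      fun i => (1 : Ω) ⊗ₜ[RatFunc (Const δ)] ((1 : RatFunc (Const δ)) ⊗ₜ[(Const δ)[X]] e i)
    rw [Set.finrank, hspan, finrank_top] at this
    simpa [M, Module.finrank_matrix] using this
  have hinj : Function.Injective ψ :=
    (LinearMap.injective_iff_surjective_of_finrank_eq_finrank (f := ψ.toLinearMap)
      (hle.antisymm (LinearMap.finrank_le_finrank_of_surjective (f := ψ.toLinearMap) hsurj))).mpr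
      hsurj
  exact ⟨AlgEquiv.ofBijective ψ ⟨hinj, hsurj⟩, hψ⟩

/-- The splitting sends `f` to its matrix over `K[x]` mapped by `ι`, and `ι` commutes with
determinants. -/
theorem norm_eq (f : DiffPoly δ) :
    f.norm = algebraMap (Const δ)[X] (RatFunc (Const δ)) (polyNorm hδ f) := by
  obtain ⟨ι, hι⟩ := exists_ringHom_algebraicClosure hδ
  obtain ⟨φ, hφ⟩ := exists_splitting hδ ι hι
  refine reducedNorm_eq _ _ _ φ ?_
  rw [hφ, ← IsScalarTower.algebraMap_apply, ← hι, map_polyNorm]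
  exact (ι.map_det _).symm

end DiffPoly
end
theorem mainTheorem11 {p : ℕ} [Fact p.Prime] {K : Type*} [Field K] [CharP K p]
    (δ : Derivation ℤ K K) (hδ : IsIntegral (DiffPoly.Const δ) (DiffPoly.derivEnd δ))
    (f : DiffPoly δ) (m : ℕ) (hf : f.degree = m)
    (h : (DiffPoly.Const δ)[X]) (hh : f.IsMinimalCentralLeftMultiple h) (hm : h.degree = m) :
    (Irreducible h → Irreducible f) ∧
    (Irreducible f → ∃ P : (DiffPoly.Const δ)[X],
      algebraMap (DiffPoly.Const δ)[X] (RatFunc (DiffPoly.Const δ)) P = f.norm ∧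
        Irreducible P) := by
  have hm' : h.natDegree = m := natDegree_eq_of_degree_eq_some hm
  exact ⟨hh.irreducible_of_irreducible hδ hf hm', fun hirr => ⟨DiffPoly.polyNorm hδ f,
    (DiffPoly.norm_eq hδ f).symm, hh.irreducible_polyNorm hδ hf hm' hirr⟩⟩
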